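/- Let $\mathbb N$ be a real antisymmetric $n\times n$ matrix of corank $1$. Then $n=2k+1$ is odd, and in a suitable orthonormal basis of $\mathbb R^n$ (given by an orthogonal matrix $Q$) $$\mathbb N=Q\begin{bmatrix}\bar{\mathbb N}&0\\0&0\end{bmatrix}Q^T$$ with $\bar{\mathbb N}$ an invertible antisymmetric $2k\times 2k$ matrix. Fix any such $Q$ and $\bar{\mathbb N}$, let $\Omega(u,v)=-u^T\bar{\mathbb N}^{-1}v$ on $\mathbb R^{2k}$, and let $$\operatorname{Jac}(\mathbb R^{2k},-\bar{\mathbb N}^{-1})=\operatorname{Sp}(\mathbb R^{2k},-\bar{\mathbb N}^{-1})\ltimes \operatorname H(\mathbb R^{2k},-\bar{\mathbb N}^{-1})$$ be the Jacobi group: the set of triples $(g,u,a)$ with $g^T\bar{\mathbb N}^{-1}g=\bar{\mathbb N}^{-1}$, $u\in\mathbb R^{2k}$, $a\in\mathbb R$, with multiplication $(g,u,a)(h,v,b)=(gh,\,u+gv,\,a+b+\tfrac12\Omega(u,gv))$. Its Lie algebra $\mathfrak{jac}$ consists of the triples $(\mathcal S_2,\mathcal S_1,\mathcal S_0)$ with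 $\mathcal S_2^T\bar{\mathbb N}^{-1}+\bar{\mathbb N}^{-1}\mathcal S_2=0$, $\mathcal S_1\in\mathbb R^{2k}$, $\mathcal S_0\in\mathbb R$, with the bracket $$[(\mathcal S_2,\mathcal S_1,\mathcal S_0),(\mathcal S_2',\mathcal S_1',\mathcal S_0')]=([\mathcal S_2,\mathcal S_2'],\ \mathcal S_2\mathcal S_1'-\mathcal S_2'\mathcal S_1,\ \Omega(\mathcal S_1,\mathcal S_1')).$$ Let $$\ell(\mathcal S_2,\mathcal S_1,\mathcal S_0)=\tfrac12\operatorname{Tr}\bigl(\mathcal S_2^T(-\bar{\mathbb N}^{-2})\mathcal S_2\bigr)+\mathcal S_1^T(-\bar{\mathbb N}^{-2})\mathcal S_1+2\mathcal S_0^2 .$$ Then the following hold. 1. $\ell$ is half the squared norm of an inner product, so that it is the kinetic energy at the identity of a left-invariant Riemannian metric on $\operatorname{Jac}(\mathbb R^{2k},-\bar{\mathbb N}^{-1})$. 2. The linear map $$\Phi(\mathcal S_2,\mathcal S_1,\mathcal S_0)=Q\begin{bmatrix}\bar{\mathbb N}^{-1}\mathcal S_2&\bar{\mathbb N}^{-1}\mathcal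 S_1\\(\bar{\mathbb N}^{-1}\mathcal S_1)^T&2\mathcal S_0\end{bmatrix}Q^T$$ is an isomorphism of Lie algebras from $\mathfrak{jac}$ to $\operatorname{Sym}(\mathbb R^n)$ with the bracket $[S,S']_{\mathbb N}=S\mathbb NS'-S'\mathbb NS$, and $\ell(\xi)=\tfrac12\operatorname{Tr}(\Phi(\xi)^2)$ for $\xi\in\mathfrak{jac}$. 3. Let $c$ be a smooth curve in $\operatorname{Jac}(\mathbb R^{2k},-\bar{\mathbb N}^{-1})$, defined on an open interval $I$, and let $\xi(t)=c(t)^{-1}\dot c(t)\in\mathfrak{jac}$ be its left-translated velocity. Then $c$ is a geodesic of this metric (that is, on each compact subinterval of $I$ it is a critical point of the energy $\int\ell(c^{-1}\dot c)\,dt$ under smooth variations with fixed end points) if and only if $\xi$ solves the Euler–Poincaré equations $\frac{d}{dt}\frac{\delta\ell}{\delta\xi}=\operatorname{ad}^*_\xi\frac{\delta\ell}{\delta\xi}$ on $I$, and if and only if $X(t)=\Phi(\xi(t))$ solves the Bloch–Iserles system $\dot X=[X^2,\mathbb N]$ on $I$. 4. Conversely, for every solution $X$ of the Bloch–Iserles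 system in $\operatorname{Sym}(\mathbb R^n)$ on an open interval $I$, every $t_0\in I$ and every point $p$ of the Jacobi group there is a geodesic $c$ on $I$ with $c(t_0)=p$ and $\Phi(c^{-1}\dot c)=X$ on $I$. -/

import Mathlib

open Matrix Set
open scoped ContDiff Matrix.Norms.Operator

noncomputable section

namespace BlochIserles

/-! ### The Heisenberg, symplectic and Jacobi groups -/

/-- The bilinear form `Ω(u, v) = uᵀ J v` on `ℝᵐ`. -/
def form {m : ℕ} (J : Matrix (Fin m) (Fin m) ℝ) (u v : Fin m → ℝ) : ℝ := u ⬝ᵥ (J *ᵥ v)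

/-- The Heisenberg group `H(ℝᵐ, J) = ℝᵐ × ℝ` with the multiplication
`(u, a)(v, b) = (u + v, a + b + ½ Ω(u, v))`. -/
@[ext]
structure Heis {m : ℕ} (J : Matrix (Fin m) (Fin m) ℝ) where
  vec : Fin m → ℝ
  scal : ℝ

/-- The term `½ Ω(u, u)` in the inverse vanishes when `J` is antisymmetric. -/
instance {m : ℕ} (J : Matrix (Fin m) (Fin m) ℝ) : Group (Heis J) where
  mul x y := ⟨x.vec + y.vec, x.scal + y.scal + 1 / 2 * form J x.vec y.vec⟩
  one := ⟨0, 0⟩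
  inv x := ⟨-x.vec, -x.scal + 1 / 2 * form J x.vec x.vec⟩
  mul_assoc x y z := by
    refine Heis.ext (add_assoc _ _ _) ?_
    change x.scal + y.scal + 1 / 2 * form J x.vec y.vec + z.scal
        + 1 / 2 * form J (x.vec + y.vec) z.vec
      = x.scal + (y.scal + z.scal + 1 / 2 * form J y.vec z.vec)
        + 1 / 2 * form J x.vec (y.vec + z.vec)
    simp only [form, mulVec_add, dotProduct_add, add_dotProduct]
    ring
  one_mul x := by
    refine Heis.ext (zero_add _) ?_
    change 0 + x.scal + 1 / 2 * form J 0 x.vec = x.scal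
    simp [form]
  mul_one x := by
    refine Heis.ext (add_zero _) ?_
    change x.scal + 0 + 1 / 2 * form J x.vec 0 = x.scal
    simp [form]
  inv_mul_cancel x := by
    refine Heis.ext (neg_add_cancel _) ?_
    change -x.scal + 1 / 2 * form J x.vec x.vec + x.scal + 1 / 2 * form J (-x.vec) x.vec = 0
    simp [form]

theorem Heis.vec_mul {m : ℕ} {J : Matrix (Fin m) (Fin m) ℝ} (x y : Heis J) :
    (x * y).vec = x.vec + y.vec := rfl

theorem Heis.scal_mul {m : ℕ} {J : Matrix (Fin m) (Fin m) ℝ} (x y : Heis J) :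
    (x * y).scal = x.scal + y.scal + 1 / 2 * form J x.vec y.vec := rfl

/-- The symplectic group `Sp(ℝᵐ, J) = {g | gᵀ J g = J}`. -/
def Symp {m : ℕ} (J : Matrix (Fin m) (Fin m) ℝ) : Subgroup (GL (Fin m) ℝ) where
  carrier := {g | g.valᵀ * J * g.val = J}
  one_mem' := by simp
  mul_mem' := by
    intro g h hg hh
    simp only [Set.mem_ofPred_eq, Units.val_mul, transpose_mul] at *
    calc h.valᵀ * g.valᵀ * J * (g.val * h.val)
        = h.valᵀ * (g.valᵀ * J * g.val) * h.val := by simp only [Matrix.mul_assoc]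
      _ = J := by rw [hg, hh]
  inv_mem' := by
    intro g hg
    simp only [Set.mem_ofPred_eq] at *
    have h1 : g.val * (g⁻¹).val = 1 := g.mul_inv
    have h2 : (g⁻¹).valᵀ * g.valᵀ = 1 := by rw [← transpose_mul, h1, transpose_one]
    calc (g⁻¹).valᵀ * J * (g⁻¹).val
        = (g⁻¹).valᵀ * (g.valᵀ * J * g.val) * (g⁻¹).val := by rw [hg]
      _ = ((g⁻¹).valᵀ * g.valᵀ) * J * (g.val * (g⁻¹).val) := by
          simp only [Matrix.mul_assoc]
      _ = J := by rw [h1, h2, Matrix.one_mul, Matrix.mul_one]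

theorem form_symp {m : ℕ} {J : Matrix (Fin m) (Fin m) ℝ} (g : Symp J) (u v : Fin m → ℝ) :
    form J (g.1.val *ᵥ u) (g.1.val *ᵥ v) = form J u v := by
  have hg : g.1.valᵀ * J * g.1.val = J := g.2
  conv_rhs => rw [← hg]
  simp only [form, ← mulVec_mulVec, dotProduct_mulVec, vecMul_transpose]

/-- The action of the symplectic group on the Heisenberg group by automorphisms,
`g(u, a) = (gu, a)`. -/
def sympAct {m : ℕ} (J : Matrix (Fin m) (Fin m) ℝ) : Symp J →* MulAut (Heis J) where
  toFun g :=
    { toFun := fun x => ⟨g.1.val *ᵥ x.vec, x.scal⟩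
      invFun := fun x => ⟨(g⁻¹).1.val *ᵥ x.vec, x.scal⟩
      left_inv := fun x => Heis.ext
        (by simp only [mulVec_mulVec, ← Units.val_mul, ← Subgroup.coe_mul]; simp) rfl
      right_inv := fun x => Heis.ext
        (by simp only [mulVec_mulVec, ← Units.val_mul, ← Subgroup.coe_mul]; simp) rfl
      map_mul' := fun x y => Heis.ext (by simp only [Heis.vec_mul, mulVec_add])
        (by simp only [Heis.scal_mul, form_symp]) }
  map_one' := by
    ext x <;> simp
  map_mul' g h := by
    ext x <;> simp

/-- The Jacobi group `Jac(ℝᵐ, J) = Sp(ℝᵐ, J) ⋉ H(ℝᵐ, J)`. -/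
abbrev Jac {m : ℕ} (J : Matrix (Fin m) (Fin m) ℝ) : Type := Heis J ⋊[sympAct J] Symp J

/-- The vector space `M_{m × m}(ℝ) × ℝᵐ × ℝ`, in which the Jacobi group is an embedded submanifold
and which contains its Lie algebra. -/
abbrev JacVec (m : ℕ) : Type := Matrix (Fin m) (Fin m) ℝ × (Fin m → ℝ) × ℝ

/-- The embedding `(g, u, a)` of the Jacobi group. -/
def coords {m : ℕ} {J : Matrix (Fin m) (Fin m) ℝ} (p : Jac J) : JacVec m :=
  (p.right.1.val, p.left.vec, p.left.scal)

/-- The multiplication `(g, u, a)(h, v, b) = (gh, u + gv, a + b + ½ Ω(u, gv))`. -/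
theorem coords_mul {m : ℕ} {J : Matrix (Fin m) (Fin m) ℝ} (p q : Jac J) :
    coords (p * q) =
      ((coords p).1 * (coords q).1,
        (coords p).2.1 + (coords p).1 *ᵥ (coords q).2.1,
        (coords p).2.2 + (coords q).2.2
          + 1 / 2 * form J (coords p).2.1 ((coords p).1 *ᵥ (coords q).2.1)) := by
  simp only [coords, SemidirectProduct.mul_left, SemidirectProduct.mul_right, Heis.vec_mul,
    Heis.scal_mul]
  rfl

/-- The Lie algebra `𝔧𝔞𝔠(ℝᵐ, J) = 𝔰𝔭(ℝᵐ, J) ⋉ 𝔥(ℝᵐ, J)`. -/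
def jacAlgebra {m : ℕ} (J : Matrix (Fin m) (Fin m) ℝ) : Submodule ℝ (JacVec m) where
  carrier := {ξ | ξ.1ᵀ * J + J * ξ.1 = 0}
  zero_mem' := by simp
  add_mem' := by
    intro ξ η hξ hη
    simp only [Set.mem_ofPred_eq, Prod.fst_add, transpose_add, Matrix.add_mul, Matrix.mul_add] at *
    calc ξ.1ᵀ * J + η.1ᵀ * J + (J * ξ.1 + J * η.1)
        = (ξ.1ᵀ * J + J * ξ.1) + (η.1ᵀ * J + J * η.1) := by abel
      _ = 0 := by rw [hξ, hη, add_zero]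
  smul_mem' := by
    intro r ξ hξ
    simp only [Set.mem_ofPred_eq, Prod.smul_fst, transpose_smul, Matrix.smul_mul,
      Matrix.mul_smul] at *
    rw [← smul_add, hξ, smul_zero]

/-- The Lie bracket of `𝔧𝔞𝔠(ℝᵐ, J)`:
`[(S₂, S₁, S₀), (S₂', S₁', S₀')] = ([S₂, S₂'], S₂ S₁' - S₂' S₁, Ω(S₁, S₁'))`. -/
def jacBracket {m : ℕ} (J : Matrix (Fin m) (Fin m) ℝ) (ξ η : JacVec m) : JacVec m :=
  (ξ.1 * η.1 - η.1 * ξ.1, ξ.1 *ᵥ η.2.1 - η.1 *ᵥ ξ.2.1, form J ξ.2.1 η.2.1)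

/-! ### Curves in the Jacobi group and geodesics of left-invariant metrics -/

/-- A curve in the Jacobi group that is smooth on the open set `I`. -/
def SmoothCurveOn {m : ℕ} {J : Matrix (Fin m) (Fin m) ℝ} (c : ℝ → Jac J) (I : Set ℝ) : Prop :=
  ContDiffOn ℝ ∞ (fun t => coords (c t)) I

/-- The left logarithmic velocity `c(t)⁻¹ ċ(t)`, an element of the Lie algebra: the velocity
`ċ(t)`, moved to the identity by the tangent map of the left translation by `c(t)⁻¹`. -/
def leftVelocity {m : ℕ} {J : Matrix (Fin m) (Fin m) ℝ} (c : ℝ → Jac J) (t : ℝ) : JacVec m :=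
  deriv (fun s => coords ((c t)⁻¹ * c s)) t

/-- Left translations do not change `c⁻¹ ċ`; so every function of it is left-invariant. -/
theorem leftVelocity_mul_left {m : ℕ} {J : Matrix (Fin m) (Fin m) ℝ} (p : Jac J)
    (c : ℝ → Jac J) : leftVelocity (fun s => p * c s) = leftVelocity c := by
  funext t
  simp only [leftVelocity, _root_.mul_inv_rev, _root_.mul_assoc, inv_mul_cancel_left]

/-- The action `∫ₐᵇ L(c, ċ) dt` for the left-invariant Lagrangian `L(c, ċ) = ℓ(c⁻¹ ċ)` on the
tangent bundle of the Jacobi group. If `ℓ` is half the squared norm of an inner product on the Lie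
algebra, then `L` is the kinetic energy of the left-invariant Riemannian metric which is this inner
product at the identity, and the action is the energy of the curve. -/
def action {m : ℕ} {J : Matrix (Fin m) (Fin m) ℝ} (ℓ : JacVec m → ℝ) (a b : ℝ)
    (c : ℝ → Jac J) : ℝ :=
  ∫ t in a..b, ℓ (leftVelocity c t)

/-- `γ ε t`, for `|ε| < δ` and `t ∈ I`, is a smooth variation of the curve `c` that keeps the points
at the times `a` and `b` fixed. -/
structure IsVariation {m : ℕ} {J : Matrix (Fin m) (Fin m) ℝ} (c : ℝ → Jac J) (I : Set ℝ)
    (a b δ : ℝ) (γ : ℝ → ℝ → Jac J) : Prop where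
  smooth : ContDiffOn ℝ ∞ (fun z : ℝ × ℝ => coords (γ z.1 z.2)) (Ioo (-δ) δ ×ˢ I)
  base : ∀ t ∈ I, γ 0 t = c t
  left : ∀ ε ∈ Ioo (-δ) δ, γ ε a = c a
  right : ∀ ε ∈ Ioo (-δ) δ, γ ε b = c b

/-- `c` is a geodesic on the open interval `I`, for the left-invariant metric whose kinetic energy
at the identity is `ℓ`: a smooth curve which, on each compact subinterval, is a critical point of
the energy among the curves with the same end points. -/
def IsGeodesicOn {m : ℕ} {J : Matrix (Fin m) (Fin m) ℝ} (ℓ : JacVec m → ℝ) (c : ℝ → Jac J)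
    (I : Set ℝ) : Prop :=
  SmoothCurveOn c I ∧
    ∀ a b : ℝ, a < b → Icc a b ⊆ I → ∀ δ > 0, ∀ γ : ℝ → ℝ → Jac J, IsVariation c I a b δ γ →
      HasDerivAt (fun ε => action ℓ a b (γ ε)) 0 0

/-- The (left) Euler–Poincaré equations `d/dt (δℓ/δξ) = ad*_ξ (δℓ/δξ)` on the dual of the Lie
algebra of the Jacobi group, tested against the elements `η` of the Lie algebra. -/
def EulerPoincareOn {m : ℕ} (J : Matrix (Fin m) (Fin m) ℝ) (ℓ : JacVec m → ℝ)
    (ξ : ℝ → JacVec m) (I : Set ℝ) : Prop :=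
  ∀ t ∈ I, ∀ η ∈ jacAlgebra J,
    HasDerivAt (fun s => fderiv ℝ ℓ (ξ s) η) (fderiv ℝ ℓ (ξ t) (jacBracket J (ξ t) η)) t

/-! ### The Bloch–Iserles system with a matrix of corank one -/

/-- `X` is a solution on `I` of the Bloch–Iserles system `Ẋ = [X², N]` on `Sym(ℝⁿ)`. -/
def BlochIserlesOn {n : ℕ} (N : Matrix (Fin n) (Fin n) ℝ)
    (X : ℝ → Matrix (Fin n) (Fin n) ℝ) (I : Set ℝ) : Prop :=
  ∀ t ∈ I, (X t).IsSymm ∧ HasDerivAt X (X t ^ 2 * N - N * X t ^ 2) t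

/-- In the orthonormal basis given by the columns of `Q`, the matrix `N` is block diagonal with the
blocks `Nbar`, invertible and antisymmetric of size `2k`, and `0`, of size one. -/
structure IsBlockForm {n k : ℕ} (N : Matrix (Fin n) (Fin n) ℝ)
    (Nbar : Matrix (Fin (2 * k)) (Fin (2 * k)) ℝ)
    (Q : Matrix (Fin n) (Fin (2 * k) ⊕ Unit) ℝ) : Prop where
  antisymm : Nbarᵀ = -Nbar
  invertible : IsUnit Nbar.det
  transpose_mul_self : Qᵀ * Q = 1
  mul_transpose_self : Q * Qᵀ = 1
  eq_blocks : N = Q * (fromBlocks Nbar 0 0 0 : Matrix (Fin (2 * k) ⊕ Unit) (Fin (2 * k) ⊕ Unit) ℝ) * Qᵀ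

/-- The map `(S₂, S₁, S₀) ↦ [[S₂, S₁ᵀ], [S₁, 2 S₀]]`; the row vector `S₁` is given as an element of
`ℝᵐ`. -/
def Psi {m : ℕ} (S : JacVec m) : Matrix (Fin m ⊕ Unit) (Fin m ⊕ Unit) ℝ :=
  fromBlocks S.1 (replicateCol Unit S.2.1) (replicateRow Unit S.2.1) (of fun _ _ => 2 * S.2.2)

/-- The inverse of the map `Γ(S₂, S₁, S₀) = (Nbar S₂, Nbar S₁ᵀ, S₀)`. -/
def GammaInv {m : ℕ} (Nbar : Matrix (Fin m) (Fin m) ℝ) (ξ : JacVec m) : JacVec m :=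
  (Nbar⁻¹ * ξ.1, Nbar⁻¹ *ᵥ ξ.2.1, ξ.2.2)

/-- The symmetric matrix that corresponds to an element of the Lie algebra of the Jacobi group. -/
def symOfJac {n k : ℕ} (Nbar : Matrix (Fin (2 * k)) (Fin (2 * k)) ℝ)
    (Q : Matrix (Fin n) (Fin (2 * k) ⊕ Unit) ℝ) (ξ : JacVec (2 * k)) :
    Matrix (Fin n) (Fin n) ℝ :=
  Q * Psi (GammaInv Nbar ξ) * Qᵀ

/-- The Lagrangian `ℓ = ½ Tr(S₂ᵀ (-Nbar⁻²) S₂) + S₁ᵀ (-Nbar⁻²) S₁ + 2 S₀²`. -/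
def lagrangian {m : ℕ} (Nbar : Matrix (Fin m) (Fin m) ℝ) (ξ : JacVec m) : ℝ :=
  1 / 2 * trace (ξ.1ᵀ * (-(Nbar⁻¹ ^ 2)) * ξ.1) + ξ.2.1 ⬝ᵥ ((-(Nbar⁻¹ ^ 2)) *ᵥ ξ.2.1)
    + 2 * ξ.2.2 ^ 2

end BlochIserles

end

open BlochIserles

/-! Write J = -N̄⁻¹. Since gᵀJg = J gives g⁻¹ = J⁻¹gᵀJ, left translation by p⁻¹ is an affine map in
the coordinates of the group, with linear part `leftForm J (coords p)`. Thus c⁻¹ċ = `leftForm` of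
(c, ċ), and the calculus takes place in the vector space `JacVec`, without manifolds.

For a family of curves with left velocity ξ and left variation field η, equality of mixed partials
and the Maurer–Cartan identity `leftBilin_sub` give ∂_ε ξ = ∂_t η + [ξ, η]. As ℓ(ξ) = ½⟨ξ, ξ⟩,
integration by parts turns the derivative of the energy into ∫ (⟨ξ, [ξ, η]⟩ - ⟨ξ̇, η⟩) dt
(`IsVariation.hasDerivAt_action`). Every field φη, with η constant in the Lie algebra and φ a smooth
function vanishing at the end points, comes from a variation, so the fundamental lemma of the
calculus of variations yields the Euler–Poincaré equations (`isGeodesicOn_iff`).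

Under Φ these become matrix equations. Membership in the Lie algebra means that N̄⁻¹S₂ is symmetric;
Φ carries the bracket to SNS' - S'NS (`symOfJac_bracket`) and the inner product to the trace form
(`metric_eq_trace`). Cyclicity of the trace (`trace_bracket`) then reads Euler–Poincaré as d/dt
Tr(XY) = Tr([X², N]Y) for all symmetric Y. Since [X², N] is itself symmetric, this is Bloch–Iserles
(`eulerPoincareOn_iff`).

Conversely, a solution X is smooth and gives ξ = Φ⁻¹X. The equation ġ = gS₂ is linear, hence
solvable on all of I, and the Heisenberg components follow by quadrature
(`exists_curve_leftVelocity_eq`). The normal form comes from a unit vector spanning the kernel of N.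
-/

namespace BlochIserles

/-! ### Differentiation of linear and bilinear maps in finite dimension -/

section Calculus

variable {E F G H : Type*} [NormedAddCommGroup E] [NormedSpace ℝ E] [FiniteDimensional ℝ E]
  [NormedAddCommGroup F] [NormedSpace ℝ F] [FiniteDimensional ℝ F]
  [NormedAddCommGroup G] [NormedSpace ℝ G]
  [NormedAddCommGroup H] [NormedSpace ℝ H]

theorem hasDerivAt_linearMap (L : E →ₗ[ℝ] G) {f : ℝ → E} {f' : E} {t : ℝ}
    (hf : HasDerivAt f f' t) : HasDerivAt (fun s => L (f s)) (L f') t :=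
  L.toContinuousLinearMap.hasFDerivAt.comp_hasDerivAt t hf

theorem hasDerivAt_bilinear (B : E →ₗ[ℝ] F →ₗ[ℝ] G) {f : ℝ → E} {g : ℝ → F} {f' : E} {g' : F}
    {t : ℝ} (hf : HasDerivAt f f' t) (hg : HasDerivAt g g' t) :
    HasDerivAt (fun s => B (f s) (g s)) (B f' (g t) + B (f t) g') t :=
  (B.toContinuousBilinearMap.hasFDerivAt.comp_hasDerivAt t hf).clm_apply hg

theorem contDiffOn_linearMap (L : E →ₗ[ℝ] G) {f : H → E} {s : Set H} {n : ℕ∞ω}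
    (hf : ContDiffOn ℝ n f s) : ContDiffOn ℝ n (fun x => L (f x)) s :=
  L.toContinuousLinearMap.contDiff.comp_contDiffOn hf

theorem contDiffOn_bilinear (B : E →ₗ[ℝ] F →ₗ[ℝ] G) {f : H → E} {g : H → F} {s : Set H}
    {n : ℕ∞ω} (hf : ContDiffOn ℝ n f s) (hg : ContDiffOn ℝ n g s) :
    ContDiffOn ℝ n (fun x => B (f x) (g x)) s :=
  (B.toContinuousBilinearMap.contDiff.comp_contDiffOn hf).clm_apply hg

end Calculus

/-! ### Left trivialization of the tangent bundle and the Maurer–Cartan equation -/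

variable {m : ℕ} {J : Matrix (Fin m) (Fin m) ℝ}

theorem inv_neg_matrix (M : Matrix (Fin m) (Fin m) ℝ) (hM : IsUnit M.det) : (-M)⁻¹ = -M⁻¹ :=
  inv_eq_left_inv (by rw [Matrix.neg_mul, Matrix.mul_neg, neg_neg, nonsing_inv_mul M hM])

theorem form_add_left (u v w : Fin m → ℝ) : form J (u + v) w = form J u w + form J v w := by
  simp [form, add_dotProduct]

theorem form_add_right (u v w : Fin m → ℝ) : form J u (v + w) = form J u v + form J u w := by
  simp [form, mulVec_add, dotProduct_add]

theorem form_smul_left (r : ℝ) (u v : Fin m → ℝ) : form J (r • u) v = r * form J u v := by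
  simp [form]

theorem form_smul_right (r : ℝ) (u v : Fin m → ℝ) : form J u (r • v) = r * form J u v := by
  simp [form, mulVec_smul]

theorem form_neg_left (u v : Fin m → ℝ) : form J (-u) v = -form J u v := by
  simp [form]

theorem form_swap (hJ : Jᵀ = -J) (u v : Fin m → ℝ) : form J u v = -form J v u := by
  have h : u ⬝ᵥ (J *ᵥ v) = v ⬝ᵥ (Jᵀ *ᵥ u) := by
    rw [dotProduct_mulVec, dotProduct_comm, mulVec_transpose]
  simp only [form]
  rw [h, hJ]
  simp [neg_mulVec]

/-- The form `Ω` as a bilinear map. -/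
noncomputable def formBilin (J : Matrix (Fin m) (Fin m) ℝ) :
    (Fin m → ℝ) →ₗ[ℝ] (Fin m → ℝ) →ₗ[ℝ] ℝ :=
  (LinearMap.mk₂ ℝ (form J) form_add_left form_smul_left form_add_right
    form_smul_right)

/-- The part of the left-trivialization `v ↦ p⁻¹ v` of the tangent bundle of the Jacobi group that
is bilinear in `p` and `v`. -/
noncomputable def leftBilin (J : Matrix (Fin m) (Fin m) ℝ) :
    JacVec m →ₗ[ℝ] JacVec m →ₗ[ℝ] JacVec m :=
  (LinearMap.mk₂ ℝ (fun p v : JacVec m =>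
    ((J⁻¹ * p.1ᵀ * J * v.1, (J⁻¹ * p.1ᵀ * J) *ᵥ v.2.1, -(1 / 2 * form J p.2.1 v.2.1)) : JacVec m))
    (fun p q v => by
      ext <;> simp [Matrix.mul_add, Matrix.add_mul, add_mulVec, form_add_left]; ring)
    (fun r p v => by
      ext <;> simp [smul_mulVec, form_smul_left]; ring)
    (fun p v w => by
      ext <;> simp [Matrix.mul_add, mulVec_add, form_add_right]; ring)
    (fun r p v => by
      ext <;> simp [mulVec_smul, form_smul_right]; ring))

theorem leftBilin_apply (p v : JacVec m) : leftBilin J p v =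
    (J⁻¹ * p.1ᵀ * J * v.1, (J⁻¹ * p.1ᵀ * J) *ᵥ v.2.1, -(1 / 2 * form J p.2.1 v.2.1)) := rfl

/-- The projection onto the central component. -/
def scalProj (m : ℕ) : JacVec m →ₗ[ℝ] JacVec m where
  toFun v := (0, 0, v.2.2)
  map_add' := by simp
  map_smul' := by simp

theorem scalProj_apply (v : JacVec m) : scalProj m v = (0, 0, v.2.2) := rfl

/-- The left-trivialization `v ↦ p⁻¹ v` of the tangent space at the point `p`. -/
noncomputable def leftForm (J : Matrix (Fin m) (Fin m) ℝ) (p : JacVec m) :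
    JacVec m →ₗ[ℝ] JacVec m :=
  leftBilin J p + scalProj m

theorem leftForm_apply (p v : JacVec m) : leftForm J p v =
    (J⁻¹ * p.1ᵀ * J * v.1, (J⁻¹ * p.1ᵀ * J) *ᵥ v.2.1, v.2.2 - 1 / 2 * form J p.2.1 v.2.1) := by
  simp only [leftForm, LinearMap.add_apply, leftBilin_apply, scalProj_apply,
    Prod.mk_add_mk, add_zero]
  congr 2
  ring

theorem contDiffOn_leftForm {H : Type*} [NormedAddCommGroup H] [NormedSpace ℝ H]
    {f g : H → JacVec m} {s : Set H} {n : ℕ∞ω} (hf : ContDiffOn ℝ n f s)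
    (hg : ContDiffOn ℝ n g s) : ContDiffOn ℝ n (fun x => leftForm J (f x) (g x)) s :=
  (contDiffOn_bilinear (leftBilin J) hf hg).add (contDiffOn_linearMap (scalProj m) hg)

theorem hasDerivAt_leftForm {f g : ℝ → JacVec m} {f' g' : JacVec m} {t : ℝ}
    (hf : HasDerivAt f f' t) (hg : HasDerivAt g g' t) :
    HasDerivAt (fun s => leftForm J (f s) (g s)) (leftBilin J f' (g t) + leftForm J (f t) g') t := by
  have h := (hasDerivAt_bilinear (leftBilin J) hf hg).add (hasDerivAt_linearMap (scalProj m) hg)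
  rw [add_assoc] at h
  exact h

/-- Replaces inversion by an expression linear in g; this is what makes `leftForm` polynomial in the
base point. -/
theorem symp_inv (hdet : IsUnit J.det) (g : Symp J) :
    (g⁻¹).1.val = J⁻¹ * g.1.valᵀ * J := by
  have hg : g.1.valᵀ * J * g.1.val = J := g.2
  have h : J⁻¹ * g.1.valᵀ * J * g.1.val = 1 := by
    calc J⁻¹ * g.1.valᵀ * J * g.1.val = J⁻¹ * (g.1.valᵀ * J * g.1.val) := by
          simp only [Matrix.mul_assoc]
      _ = 1 := by rw [hg, nonsing_inv_mul _ hdet]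
  have h2 : g.1.val * (g⁻¹).1.val = 1 := g.1.mul_inv
  calc (g⁻¹).1.val = (J⁻¹ * g.1.valᵀ * J * g.1.val) * (g⁻¹).1.val := by rw [h, Matrix.one_mul]
    _ = _ := by rw [Matrix.mul_assoc _ g.1.val, h2, Matrix.mul_one]

theorem coords_one : coords (1 : Jac J) = (1, 0, 0) := rfl

theorem coords_inv (hdet : IsUnit J.det) (p : Jac J) :
    (coords p⁻¹).1 = J⁻¹ * (coords p).1ᵀ * J ∧
      (coords p⁻¹).2.1 = -((J⁻¹ * (coords p).1ᵀ * J) *ᵥ (coords p).2.1) := by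
  have h1 : (coords p⁻¹).1 = J⁻¹ * (coords p).1ᵀ * J := symp_inv hdet p.right
  refine ⟨h1, ?_⟩
  have h := coords_mul p⁻¹ p
  rw [inv_mul_cancel, coords_one] at h
  have h2 := (Prod.ext_iff.1 (Prod.ext_iff.1 h).2).1
  simp only [h1] at h2
  exact eq_neg_of_add_eq_zero_left h2.symm

theorem form_coords (hdet : IsUnit J.det) (p : Jac J) (u v : Fin m → ℝ) :
    form J ((J⁻¹ * (coords p).1ᵀ * J) *ᵥ u) ((J⁻¹ * (coords p).1ᵀ * J) *ᵥ v) = form J u v := by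
  rw [← (coords_inv hdet p).1]
  exact form_symp p⁻¹.right u v

/-- For fixed p the product is affine in q, so its derivative is `leftForm J (coords p)`. The matrix
component has no constant term, whence the subtraction. -/
theorem coords_inv_mul (hdet : IsUnit J.det) (p q : Jac J) :
    coords (p⁻¹ * q) = leftForm J (coords p) (coords q) + coords p⁻¹
      - ((coords p⁻¹).1, 0, 0) := by
  obtain ⟨h1, h2⟩ := coords_inv hdet p
  rw [coords_mul, leftForm_apply, h1, h2]
  refine Prod.ext ?_ (Prod.ext ?_ ?_)
  · simp [h1]
  · simp [h2]; abel
  · simp only [form_neg_left, form_coords hdet]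
    simp
    ring

theorem leftVelocity_eq (hdet : IsUnit J.det) {c : ℝ → Jac J} {t : ℝ} {v : JacVec m}
    (h : HasDerivAt (fun s => coords (c s)) v t) :
    leftVelocity c t = leftForm J (coords (c t)) v := by
  unfold leftVelocity
  simp only [coords_inv_mul hdet]
  exact (((hasDerivAt_linearMap (leftForm J (coords (c t))) h).add_const _).sub_const _).deriv

theorem coords_symp (p : Jac J) : (coords p).1ᵀ * J * (coords p).1 = J := p.right.2

/-- Differentiate the constraint gᵀJg = J, which holds at every time because c takes values in the
group. -/
theorem tangent_of_hasDerivAt {c : ℝ → Jac J} {t : ℝ} {v : JacVec m}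
    (h : HasDerivAt (fun s => coords (c s)) v t) :
    v.1ᵀ * J * (coords (c t)).1 + (coords (c t)).1ᵀ * J * v.1 = 0 := by
  have h1 : HasDerivAt (fun s => (coords (c s)).1) v.1 t :=
    h.fst
  have hT : HasDerivAt (fun s => (coords (c s)).1ᵀ) v.1ᵀ t :=
    hasDerivAt_linearMap (Matrix.transposeLinearEquiv (Fin m) (Fin m) ℝ ℝ).toLinearMap h1
  have h3 := ((hT.mul_const J).mul h1)
  have h4 : (fun s => (coords (c s)).1ᵀ * J) * (fun s => (coords (c s)).1) = fun _ => J := by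
    funext s
    exact coords_symp (c s)
  rw [h4] at h3
  exact h3.unique (hasDerivAt_const t J)

/-- The left-trivialization maps tangent vectors of the group to the Lie algebra. -/
theorem leftForm_mem (hdet : IsUnit J.det) (hJ : Jᵀ = -J) {p v : JacVec m}
    (hv : v.1ᵀ * J * p.1 + p.1ᵀ * J * v.1 = 0) : leftForm J p v ∈ jacAlgebra J := by
  change (leftForm J p v).1ᵀ * J + J * (leftForm J p v).1 = 0
  rw [leftForm_apply, ← hv]
  simp only [transpose_mul, transpose_transpose, transpose_nonsing_inv, hJ]
  have h1 : (-J)⁻¹ * J = -1 := by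
    rw [inv_neg_matrix J hdet, Matrix.neg_mul, nonsing_inv_mul J hdet]
  have h2 : J * J⁻¹ = 1 := mul_nonsing_inv J hdet
  calc _ = -(v.1ᵀ * J * p.1 * ((-J)⁻¹ * J)) + J * J⁻¹ * (p.1ᵀ * J * v.1) := by
        simp only [Matrix.mul_assoc, Matrix.neg_mul, Matrix.mul_neg]
    _ = _ := by rw [h1, h2]; simp

/-- The Maurer–Cartan equation. -/
theorem leftBilin_sub (hdet : IsUnit J.det) (hJ : Jᵀ = -J) (p : Jac J) {v w : JacVec m}
    (hv : v.1ᵀ * J * (coords p).1 + (coords p).1ᵀ * J * v.1 = 0)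
    (hw : w.1ᵀ * J * (coords p).1 + (coords p).1ᵀ * J * w.1 = 0) :
    leftBilin J v w - leftBilin J w v =
      jacBracket J (leftForm J (coords p) w) (leftForm J (coords p) v) := by
  set q := coords p with hq
  set A := J⁻¹ * q.1ᵀ * J with hA
  have hgA : q.1 * A = 1 := by
    rw [hA, hq, ← (coords_inv hdet p).1]
    exact p.right.1.mul_inv
  have key : ∀ x : JacVec m, x.1ᵀ * J * q.1 + q.1ᵀ * J * x.1 = 0 →
      x.1ᵀ * J = -(q.1ᵀ * J * x.1 * A) := by
    intro x hx
    calc x.1ᵀ * J = x.1ᵀ * J * q.1 * A := by rw [Matrix.mul_assoc _ q.1, hgA, Matrix.mul_one]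
      _ = _ := by rw [eq_neg_of_add_eq_zero_left hx, Matrix.neg_mul]
  -- With A = g⁻¹ this is the derivative of inversion, d(g⁻¹) = -g⁻¹ dg g⁻¹; the antisymmetrized
  -- products become a commutator.
  have key2 : ∀ x : JacVec m, x.1ᵀ * J * q.1 + q.1ᵀ * J * x.1 = 0 →
      J⁻¹ * x.1ᵀ * J = -(A * x.1 * A) := by
    intro x hx
    rw [Matrix.mul_assoc, key x hx, hA]
    simp only [Matrix.mul_neg, Matrix.mul_assoc]
  rw [leftForm_apply, leftForm_apply, leftBilin_apply, leftBilin_apply, jacBracket, key2 v hv,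
    key2 w hw]
  refine Prod.ext ?_ (Prod.ext ?_ ?_)
  · simp only [Prod.fst_sub, ← hA]
    noncomm_ring
  · simp only [Prod.fst_sub, Prod.snd_sub, ← hA, mulVec_mulVec, Matrix.mul_assoc, neg_mulVec]
    abel
  -- The two halves -½Ω(v, w) and ½Ω(w, v) add up to Ω(w, v), which A preserves.
  · simp only [Prod.snd_sub, form_coords hdet, hA, hq]
    rw [form_swap hJ v.2.1 w.2.1]
    ring

/-! ### The inner product behind the Lagrangian -/

/-- The left-invariant metric at the identity. -/
noncomputable def metric (M : Matrix (Fin m) (Fin m) ℝ) : LinearMap.BilinForm ℝ (JacVec m) :=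
  LinearMap.mk₂ ℝ (fun ξ η : JacVec m => trace ((M * ξ.1)ᵀ * (M * η.1))
      + 2 * ((M *ᵥ ξ.2.1) ⬝ᵥ (M *ᵥ η.2.1)) + 4 * (ξ.2.2 * η.2.2))
    (fun p q v => by
      simp [Matrix.mul_add, Matrix.add_mul, mulVec_add, add_dotProduct]; ring)
    (fun r p v => by
      simp [mulVec_smul]; ring)
    (fun p v w => by
      simp [Matrix.mul_add, mulVec_add, dotProduct_add]; ring)
    (fun r p v => by
      simp [mulVec_smul]; ring)

theorem metric_apply (M : Matrix (Fin m) (Fin m) ℝ) (ξ η : JacVec m) : metric M ξ η =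
    trace ((M * ξ.1)ᵀ * (M * η.1))
      + 2 * ((M *ᵥ ξ.2.1) ⬝ᵥ (M *ᵥ η.2.1)) + 4 * (ξ.2.2 * η.2.2) := rfl

theorem metric_comm (M : Matrix (Fin m) (Fin m) ℝ) (ξ η : JacVec m) :
    metric M ξ η = metric M η ξ := by
  rw [metric_apply, metric_apply, ← trace_transpose, transpose_mul, transpose_transpose,
    dotProduct_comm, mul_comm ξ.2.2]

theorem metric_pos {M : Matrix (Fin m) (Fin m) ℝ} (hM : IsUnit M.det) {ξ : JacVec m} (hξ : ξ ≠ 0) :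
    0 < metric M ξ ξ := by
  have h1 : 0 ≤ trace ((M * ξ.1)ᵀ * (M * ξ.1)) := by
    rw [← conjTranspose_eq_transpose_of_trivial]
    exact (posSemidef_conjTranspose_mul_self _).trace_nonneg
  have h2 : 0 ≤ (M *ᵥ ξ.2.1) ⬝ᵥ (M *ᵥ ξ.2.1) := dotProduct_self_star_nonneg _
  have h3 : 0 ≤ ξ.2.2 * ξ.2.2 := mul_self_nonneg _
  rw [metric_apply]
  refine lt_of_le_of_ne (by positivity) fun h0 => hξ ?_
  have e1 : trace ((M * ξ.1)ᵀ * (M * ξ.1)) = 0 := by linarith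
  have e2 : (M *ᵥ ξ.2.1) ⬝ᵥ (M *ᵥ ξ.2.1) = 0 := by linarith
  have e3 : ξ.2.2 * ξ.2.2 = 0 := by linarith
  rw [← conjTranspose_eq_transpose_of_trivial, trace_conjTranspose_mul_self_eq_zero_iff] at e1
  rw [dotProduct_self_eq_zero] at e2
  have hinj := mulVec_injective_of_isUnit ((isUnit_iff_isUnit_det M).2 hM)
  refine Prod.ext ?_ (Prod.ext ?_ (mul_self_eq_zero.1 e3))
  · rw [← Matrix.one_mul ξ.1, ← nonsing_inv_mul M hM, Matrix.mul_assoc, e1]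
    simp
  · exact hinj (by rw [e2]; simp)

/-- For the antisymmetric matrix M = N̄⁻¹ one has MᵀM = -M². -/
theorem lagrangian_eq {Nbar : Matrix (Fin m) (Fin m) ℝ} (hN : Nbarᵀ = -Nbar)
    (hdet : IsUnit Nbar.det) (ξ : JacVec m) :
    lagrangian Nbar ξ = 1 / 2 * metric Nbar⁻¹ ξ ξ := by
  have hT : (Nbar⁻¹)ᵀ = -Nbar⁻¹ := by
    rw [transpose_nonsing_inv, hN, inv_neg_matrix _ hdet]
  rw [lagrangian, metric_apply, transpose_mul, hT]
  have h1 : (Nbar⁻¹ *ᵥ ξ.2.1) ⬝ᵥ (Nbar⁻¹ *ᵥ ξ.2.1) = ξ.2.1 ⬝ᵥ ((-(Nbar⁻¹ ^ 2)) *ᵥ ξ.2.1) := by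
    rw [dotProduct_mulVec, ← mulVec_transpose, mulVec_mulVec, hT, dotProduct_comm, Matrix.neg_mul,
      pow_two]
  have h2 : ξ.1ᵀ * -Nbar⁻¹ * (Nbar⁻¹ * ξ.1) = ξ.1ᵀ * (-(Nbar⁻¹ ^ 2)) * ξ.1 := by
    simp only [pow_two, Matrix.mul_assoc, Matrix.neg_mul, Matrix.mul_neg]
  rw [h1, h2]
  ring

end BlochIserles

/-! ### The isomorphism with symmetric matrices; Euler–Poincaré and Bloch–Iserles -/

namespace BlochIserles

variable {n k m : ℕ} {N : Matrix (Fin n) (Fin n) ℝ}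
  {Nbar : Matrix (Fin (2 * k)) (Fin (2 * k)) ℝ} {Q : Matrix (Fin n) (Fin (2 * k) ⊕ Unit) ℝ}

theorem Psi_add (S T : JacVec m) : Psi (S + T) = Psi S + Psi T := by
  ext (i | i) (j | j) <;> simp [Psi, mul_add]

theorem Psi_smul (r : ℝ) (S : JacVec m) : Psi (r • S) = r • Psi S := by
  ext (i | i) (j | j) <;> simp [Psi]
  ring

theorem GammaInv_add (M : Matrix (Fin m) (Fin m) ℝ) (S T : JacVec m) :
    GammaInv M (S + T) = GammaInv M S + GammaInv M T := by
  simp [GammaInv, Matrix.mul_add, mulVec_add]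

theorem GammaInv_smul (M : Matrix (Fin m) (Fin m) ℝ) (r : ℝ) (S : JacVec m) :
    GammaInv M (r • S) = r • GammaInv M S := by
  simp [GammaInv, mulVec_smul]

theorem isLinearMap_symOfJac (Nbar : Matrix (Fin (2 * k)) (Fin (2 * k)) ℝ)
    (Q : Matrix (Fin n) (Fin (2 * k) ⊕ Unit) ℝ) : IsLinearMap ℝ (symOfJac Nbar Q) where
  map_add ξ η := by simp only [symOfJac, GammaInv_add, Psi_add, Matrix.mul_add, Matrix.add_mul]
  map_smul r ξ := by simp only [symOfJac, GammaInv_smul, Psi_smul, Matrix.mul_smul, Matrix.smul_mul]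

/-- As N̄⁻¹ is antisymmetric, S₂ᵀN̄⁻¹ = -(N̄⁻¹S₂)ᵀ. This is why symmetric matrices appear. -/
theorem mem_jacAlgebra_iff (hNbar : Nbarᵀ = -Nbar) (hdet : IsUnit Nbar.det) (ξ : JacVec (2 * k)) :
    ξ ∈ jacAlgebra (-Nbar⁻¹) ↔ (Nbar⁻¹ * ξ.1)ᵀ = Nbar⁻¹ * ξ.1 := by
  change ξ.1ᵀ * (-Nbar⁻¹) + (-Nbar⁻¹) * ξ.1 = 0 ↔ _
  rw [transpose_mul, transpose_nonsing_inv, hNbar, inv_neg_matrix _ hdet, Matrix.neg_mul,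
    ← sub_eq_add_neg, sub_eq_zero]

theorem Psi_transpose (S : JacVec m) : (Psi S)ᵀ = Psi (S.1ᵀ, S.2.1, S.2.2) := by
  ext (i | i) (j | j) <;> simp [Psi]

/-- The inverse of `symOfJac`. -/
noncomputable def jacOfSym (Nbar : Matrix (Fin (2 * k)) (Fin (2 * k)) ℝ)
    (Q : Matrix (Fin n) (Fin (2 * k) ⊕ Unit) ℝ) :
    Matrix (Fin n) (Fin n) ℝ →ₗ[ℝ] JacVec (2 * k) where
  toFun S := (Nbar * (Qᵀ * S * Q).toBlocks₁₁,
    Nbar *ᵥ (fun i => (Qᵀ * S * Q) (Sum.inl i) (Sum.inr ())),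
    2⁻¹ * (Qᵀ * S * Q) (Sum.inr ()) (Sum.inr ()))
  map_add' S T := by
    simp only [Matrix.mul_add, Matrix.add_mul]
    refine Prod.ext ?_ (Prod.ext ?_ ?_)
    · simp only [Prod.fst_add, ← Matrix.mul_add]
      rfl
    · simp only [Prod.fst_add, Prod.snd_add, ← mulVec_add]
      rfl
    · simp [mul_add]
  map_smul' r S := by
    have hs : Qᵀ * (r • S) * Q = r • (Qᵀ * S * Q) := by
      rw [Matrix.mul_smul, Matrix.smul_mul]
    simp only [hs, RingHom.id_apply]
    refine Prod.ext ?_ (Prod.ext ?_ ?_)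
    · exact Matrix.mul_smul Nbar r (Qᵀ * S * Q).toBlocks₁₁
    · simp only [Prod.smul_fst, Prod.smul_snd, ← mulVec_smul]
      rfl
    · simp
      ring

theorem jacOfSym_apply (S : Matrix (Fin n) (Fin n) ℝ) : jacOfSym Nbar Q S =
    (Nbar * (Qᵀ * S * Q).toBlocks₁₁,
    Nbar *ᵥ (fun i => (Qᵀ * S * Q) (Sum.inl i) (Sum.inr ())),
    2⁻¹ * (Qᵀ * S * Q) (Sum.inr ()) (Sum.inr ())) := rfl

theorem jacOfSym_symOfJac (h : IsBlockForm N Nbar Q) (ξ : JacVec (2 * k)) :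
    jacOfSym Nbar Q (symOfJac Nbar Q ξ) = ξ := by
  have h1 : Qᵀ * symOfJac Nbar Q ξ * Q = Psi (GammaInv Nbar ξ) := by
    calc _ = (Qᵀ * Q) * Psi (GammaInv Nbar ξ) * (Qᵀ * Q) := by
          simp only [symOfJac, Matrix.mul_assoc]
      _ = _ := by rw [h.transpose_mul_self, Matrix.one_mul, Matrix.mul_one]
  rw [jacOfSym_apply, h1]
  refine Prod.ext ?_ (Prod.ext ?_ ?_)
  · simp only [Psi, toBlocks_fromBlocks₁₁, GammaInv, ← Matrix.mul_assoc,
      mul_nonsing_inv _ h.invertible, Matrix.one_mul]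
  · simp only [Psi, fromBlocks_apply₁₂, GammaInv, replicateCol_apply]
    exact (mulVec_mulVec _ _ _).trans (by rw [mul_nonsing_inv _ h.invertible, one_mulVec])
  · simp [Psi, GammaInv]

/-- `jacOfSym` never reads the lower left block, which is recovered from the upper right one by
symmetry. -/
theorem symOfJac_jacOfSym (h : IsBlockForm N Nbar Q) {S : Matrix (Fin n) (Fin n) ℝ}
    (hS : S.IsSymm) : symOfJac Nbar Q (jacOfSym Nbar Q S) = S := by
  have hT : (Qᵀ * S * Q).IsSymm := by
    simp only [IsSymm, transpose_mul, transpose_transpose, hS.eq, Matrix.mul_assoc]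
  have h1 : Psi (GammaInv Nbar (jacOfSym Nbar Q S)) = Qᵀ * S * Q := by
    rw [jacOfSym_apply, GammaInv]
    simp only [← Matrix.mul_assoc, mulVec_mulVec, nonsing_inv_mul _ h.invertible, Matrix.one_mul,
      one_mulVec]
    ext (i | i) (j | j)
    · rfl
    · rfl
    · exact (hT.apply _ _).symm.trans rfl
    · simp [Psi]
  calc _ = (Q * Qᵀ) * S * (Q * Qᵀ) := by
        simp only [symOfJac, h1, Matrix.mul_assoc]
    _ = _ := by rw [h.mul_transpose_self, Matrix.one_mul, Matrix.mul_one]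

theorem jacOfSym_mem (h : IsBlockForm N Nbar Q) {S : Matrix (Fin n) (Fin n) ℝ}
    (hS : S.IsSymm) : jacOfSym Nbar Q S ∈ jacAlgebra (-Nbar⁻¹) := by
  have hT : (Qᵀ * S * Q).IsSymm := by
    simp only [IsSymm, transpose_mul, transpose_transpose, hS.eq, Matrix.mul_assoc]
  rw [mem_jacAlgebra_iff h.antisymm h.invertible, jacOfSym_apply]
  simp only [← Matrix.mul_assoc Nbar⁻¹ Nbar, nonsing_inv_mul _ h.invertible, Matrix.one_mul]
  ext i j
  exact hT.apply (Sum.inl i) (Sum.inl j)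

theorem isSymm_symOfJac (h : IsBlockForm N Nbar Q) {ξ : JacVec (2 * k)}
    (hξ : ξ ∈ jacAlgebra (-Nbar⁻¹)) : (symOfJac Nbar Q ξ).IsSymm := by
  rw [mem_jacAlgebra_iff h.antisymm h.invertible] at hξ
  have h1 : (Psi (GammaInv Nbar ξ))ᵀ = Psi (GammaInv Nbar ξ) := by
    rw [Psi_transpose]
    simp only [GammaInv, hξ]
  simp only [IsSymm, symOfJac, transpose_mul, transpose_transpose, h1, Matrix.mul_assoc]

theorem bijOn_symOfJac (h : IsBlockForm N Nbar Q) :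
    BijOn (symOfJac Nbar Q) (jacAlgebra (-Nbar⁻¹)) {S | S.IsSymm} :=
  BijOn.mk (fun _ hξ => isSymm_symOfJac h hξ)
    (fun ξ _ η _ he => by rw [← jacOfSym_symOfJac h ξ, he, jacOfSym_symOfJac h])
    fun S hS => ⟨jacOfSym Nbar Q S, jacOfSym_mem h hS, symOfJac_jacOfSym h hS⟩

/-- The zero corner of the middle factor removes the scalar entries of S and T: the central
component does not enter the bracket. -/
theorem Psi_mul_fromBlocks_mul (S T : JacVec m) (A : Matrix (Fin m) (Fin m) ℝ) :
    Psi S * (fromBlocks A 0 0 0 : Matrix (Fin m ⊕ Unit) (Fin m ⊕ Unit) ℝ) * Psi T =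
      fromBlocks (S.1 * A * T.1) (replicateCol Unit ((S.1 * A) *ᵥ T.2.1))
        (replicateRow Unit ((S.2.1 ᵥ* A) ᵥ* T.1)) (of fun _ _ => S.2.1 ⬝ᵥ (A *ᵥ T.2.1)) := by
  rw [Psi, Psi, fromBlocks_multiply, fromBlocks_multiply]
  simp only [Matrix.mul_zero, add_zero, Matrix.zero_mul]
  ext (i | i) (j | j)
  · rfl
  · rfl
  · rfl
  · exact (dotProduct_mulVec S.2.1 A T.2.1).symm

/-- Between two factors QᵀQ = 1 cancels, as does N̄N̄⁻¹ in each block. The corner becomes Ω(S₁, S₁')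
- Ω(S₁', S₁) = 2Ω(S₁, S₁'), which explains the entry 2S₀ in Φ. -/
theorem symOfJac_bracket (h : IsBlockForm N Nbar Q) {ξ η : JacVec (2 * k)}
    (hξ : ξ ∈ jacAlgebra (-Nbar⁻¹)) (hη : η ∈ jacAlgebra (-Nbar⁻¹)) :
    symOfJac Nbar Q (jacBracket (-Nbar⁻¹) ξ η) =
      symOfJac Nbar Q ξ * N * symOfJac Nbar Q η - symOfJac Nbar Q η * N * symOfJac Nbar Q ξ := by
  rw [mem_jacAlgebra_iff h.antisymm h.invertible] at hξ hη
  have hM : (Nbar⁻¹)ᵀ = -Nbar⁻¹ := by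
    rw [transpose_nonsing_inv, h.antisymm, inv_neg_matrix _ h.invertible]
  have e : ∀ x y : JacVec (2 * k), symOfJac Nbar Q x * N * symOfJac Nbar Q y =
      Q * (Psi (GammaInv Nbar x) * (fromBlocks Nbar 0 0 0 :
        Matrix (Fin (2 * k) ⊕ Unit) (Fin (2 * k) ⊕ Unit) ℝ) * Psi (GammaInv Nbar y)) * Qᵀ := by
    intro x y
    calc _ = Q * (Psi (GammaInv Nbar x) * (Qᵀ * Q) * (fromBlocks Nbar 0 0 0 :
        Matrix (Fin (2 * k) ⊕ Unit) (Fin (2 * k) ⊕ Unit) ℝ) * (Qᵀ * Q) * Psi (GammaInv Nbar y))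
          * Qᵀ := by
          simp only [symOfJac, h.eq_blocks, Matrix.mul_assoc]
      _ = _ := by rw [h.transpose_mul_self, Matrix.mul_one, Matrix.mul_one]
  have hMN : Nbar * Nbar⁻¹ = 1 := mul_nonsing_inv _ h.invertible
  have e1 : ∀ x y : Matrix (Fin (2 * k)) (Fin (2 * k)) ℝ,
      Nbar⁻¹ * x * Nbar * (Nbar⁻¹ * y) = Nbar⁻¹ * x * y := by
    intro x y
    rw [Matrix.mul_assoc _ Nbar, ← Matrix.mul_assoc Nbar, hMN, Matrix.one_mul]
  have e2 : ∀ (x : Matrix (Fin (2 * k)) (Fin (2 * k)) ℝ) (u : Fin (2 * k) → ℝ),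
      (Nbar⁻¹ * x * Nbar) *ᵥ (Nbar⁻¹ *ᵥ u) = Nbar⁻¹ *ᵥ (x *ᵥ u) := by
    intro x u
    rw [mulVec_mulVec, Matrix.mul_assoc _ Nbar, hMN, Matrix.mul_one, mulVec_mulVec]
  -- The row block is where membership in the Lie algebra is used: symmetry of N̄⁻¹x turns the row
  -- product into a column product.
  have e3 : ∀ (x : Matrix (Fin (2 * k)) (Fin (2 * k)) ℝ) (u : Fin (2 * k) → ℝ),
      (Nbar⁻¹ * x)ᵀ = Nbar⁻¹ * x →
      ((Nbar⁻¹ *ᵥ u) ᵥ* Nbar) ᵥ* (Nbar⁻¹ * x) = -(Nbar⁻¹ *ᵥ (x *ᵥ u)) := by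
    intro x u hx
    have e4 : (Nbar⁻¹ *ᵥ u) ᵥ* Nbar = -u := by
      rw [← mulVec_transpose, h.antisymm, mulVec_mulVec, Matrix.neg_mul, hMN, neg_mulVec,
        one_mulVec]
    rw [e4, ← mulVec_transpose, hx, mulVec_neg, mulVec_mulVec]
  have e5 : ∀ u v : Fin (2 * k) → ℝ, (Nbar⁻¹ *ᵥ u) ⬝ᵥ (Nbar *ᵥ (Nbar⁻¹ *ᵥ v)) =
      form (-Nbar⁻¹) u v := by
    intro u v
    rw [mulVec_mulVec, hMN, one_mulVec, dotProduct_comm, dotProduct_mulVec, ← mulVec_transpose,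
      hM, dotProduct_comm, form]
  have hsw := form_swap (J := -Nbar⁻¹) (by rw [transpose_neg, hM]) η.2.1 ξ.2.1
  rw [e, e, ← Matrix.sub_mul, ← Matrix.mul_sub, symOfJac, Psi_mul_fromBlocks_mul,
    Psi_mul_fromBlocks_mul]
  congr 2
  simp only [GammaInv, e1, e2, e3 _ _ hξ, e3 _ _ hη, e5, hsw, jacBracket]
  ext (i | i) (j | j)
  · simp [Psi, Matrix.mul_sub, Matrix.mul_assoc]
  · simp [Psi, mulVec_sub]
  · simp [Psi, mulVec_sub]
    ring
  · simp [Psi]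
    ring

theorem trace_fromBlocks_sum {α β : Type*} [Fintype α] [Fintype β] (A : Matrix α α ℝ)
    (B : Matrix α β ℝ) (C : Matrix β α ℝ) (D : Matrix β β ℝ) :
    trace (fromBlocks A B C D) = trace A + trace D := by
  simp [trace]

/-- The trace form counts the vector twice, as row and as column, and the corner contributes 2S₀ ·
2S₀'; hence the weights 2 and 4 in `metric`. -/
theorem metric_eq_trace (h : IsBlockForm N Nbar Q) (ξ η : JacVec (2 * k)) :
    metric Nbar⁻¹ ξ η = trace ((symOfJac Nbar Q ξ)ᵀ * symOfJac Nbar Q η) := by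
  have h1 : (symOfJac Nbar Q ξ)ᵀ * symOfJac Nbar Q η =
      Q * ((Psi (GammaInv Nbar ξ))ᵀ * Psi (GammaInv Nbar η)) * Qᵀ := by
    calc _ = Q * ((Psi (GammaInv Nbar ξ))ᵀ * (Qᵀ * Q) * Psi (GammaInv Nbar η)) * Qᵀ := by
          simp only [symOfJac, transpose_mul, transpose_transpose, Matrix.mul_assoc]
      _ = _ := by rw [h.transpose_mul_self, Matrix.mul_one]
  rw [h1, trace_mul_comm, ← Matrix.mul_assoc, h.transpose_mul_self, Matrix.one_mul, Psi_transpose,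
    metric_apply]
  simp only [Psi, GammaInv, fromBlocks_multiply]
  rw [trace_fromBlocks_sum, trace_add]
  have e1 : ∀ u v : Fin (2 * k) → ℝ, trace (replicateCol Unit u * replicateRow Unit v) = u ⬝ᵥ v := by
    intro u v
    simp [trace, Matrix.mul_apply, dotProduct]
  have e2 : ∀ u v : Fin (2 * k) → ℝ, trace (replicateRow Unit u * replicateCol Unit v) = u ⬝ᵥ v := by
    intro u v
    simp [trace, Matrix.mul_apply, dotProduct]
  rw [trace_add, e1, e2]
  simp [trace, Matrix.mul_apply]
  ring

/-- Computes the coadjoint term: under the trace pairing, ad*_X X is represented by [X², N]. -/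
theorem trace_bracket (X Y : Matrix (Fin n) (Fin n) ℝ) :
    trace (X * (X * N * Y - Y * N * X)) = trace ((X ^ 2 * N - N * X ^ 2) * Y) := by
  rw [Matrix.mul_sub, Matrix.sub_mul, trace_sub, trace_sub]
  have h1 : X * (X * N * Y) = X ^ 2 * N * Y := by simp only [pow_two, Matrix.mul_assoc]
  have h2 : trace (X * (Y * N * X)) = trace (N * X ^ 2 * Y) := by
    rw [show X * (Y * N * X) = (X * Y) * (N * X) by simp only [Matrix.mul_assoc], trace_mul_comm]
    simp only [pow_two, Matrix.mul_assoc]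
  rw [h1, h2]

theorem fderiv_quadratic {E : Type*} [NormedAddCommGroup E] [NormedSpace ℝ E]
    [FiniteDimensional ℝ E] (B : E →ₗ[ℝ] E →ₗ[ℝ] ℝ) (x v : E) :
    fderiv ℝ (fun y => 1 / 2 * B y y) x v = 1 / 2 * (B x v + B v x) := by
  have h := ((B.toContinuousBilinearMap.hasFDerivAt (x := x)).clm_apply
    (hasFDerivAt_id x)).const_mul (1 / 2)
  have h2 : fderiv ℝ (fun y => 1 / 2 * B y y) x = _ := h.fderiv
  rw [h2]
  simp
  ring

theorem fderiv_lagrangian (h : IsBlockForm N Nbar Q) (ξ η : JacVec (2 * k)) :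
    fderiv ℝ (lagrangian Nbar) ξ η = metric Nbar⁻¹ ξ η := by
  have h1 : lagrangian Nbar = fun ξ => 1 / 2 * metric Nbar⁻¹ ξ ξ := by
    funext ξ
    exact lagrangian_eq h.antisymm h.invertible ξ
  rw [h1]
  refine (fderiv_quadratic (metric Nbar⁻¹) ξ η).trans ?_
  rw [metric_comm _ η ξ]
  ring

/-- Pairing with symmetric matrices sees only the symmetric part, so this is needed to recover the
full equation. -/
theorem transpose_blochIserles (hN : Nᵀ = -N) {X : Matrix (Fin n) (Fin n) ℝ} (hX : X.IsSymm) :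
    (X ^ 2 * N - N * X ^ 2)ᵀ = X ^ 2 * N - N * X ^ 2 := by
  simp only [transpose_sub, transpose_mul, transpose_pow, hX.eq, hN]
  simp only [Matrix.neg_mul, Matrix.mul_neg]
  abel

theorem eulerPoincareOn_iff (h : IsBlockForm N Nbar Q) (hN : Nᵀ = -N) {I : Set ℝ} (hI : IsOpen I)
    {ξ : ℝ → JacVec (2 * k)} (hξ : ∀ t ∈ I, ξ t ∈ jacAlgebra (-Nbar⁻¹)) :
    EulerPoincareOn (-Nbar⁻¹) (lagrangian Nbar) ξ I ↔
      BlochIserlesOn N (fun t => symOfJac Nbar Q (ξ t)) I := by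
  have key : ∀ t ∈ I, ∀ η ∈ jacAlgebra (-Nbar⁻¹),
      fderiv ℝ (lagrangian Nbar) (ξ t) (jacBracket (-Nbar⁻¹) (ξ t) η) =
        trace ((symOfJac Nbar Q (ξ t) ^ 2 * N - N * symOfJac Nbar Q (ξ t) ^ 2)
          * symOfJac Nbar Q η) := by
    intro t ht η hη
    rw [fderiv_lagrangian h, metric_eq_trace h, symOfJac_bracket h (hξ t ht) hη,
      (isSymm_symOfJac h (hξ t ht)).eq, trace_bracket]
  constructor
  · intro hEP t ht
    refine ⟨isSymm_symOfJac h (hξ t ht), ?_⟩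
    set X := fun t => symOfJac Nbar Q (ξ t) with hX
    set Z := X t ^ 2 * N - N * X t ^ 2 with hZ
    have hZs : Zᵀ = Z := transpose_blochIserles hN (isSymm_symOfJac h (hξ t ht))
    have entry : ∀ i j, HasDerivAt (fun s => X s i j) (Z i j) t := by
      intro i j
      -- Symmetric test matrix: its pairing with a symmetric W is 2W_ij, also when i = j.
      set Y : Matrix (Fin n) (Fin n) ℝ := single i j 1 + single j i 1 with hY
      have hYs : Y.IsSymm := by
        simp only [IsSymm, hY, transpose_add, transpose_single, add_comm]
      have htr : ∀ W : Matrix (Fin n) (Fin n) ℝ, Wᵀ = W → trace (W * Y) = 2 * W i j := by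
        intro W hW
        have e : W j i = W i j := by
          conv_lhs => rw [← hW]
          rfl
        rw [hY, Matrix.mul_add, trace_add, trace_mul_single, trace_mul_single, e]
        simp
        ring
      have h1 := hEP t ht _ (jacOfSym_mem h hYs)
      rw [key t ht _ (jacOfSym_mem h hYs), symOfJac_jacOfSym h hYs, htr _ hZs] at h1
      have h2 : (fun s => fderiv ℝ (lagrangian Nbar) (ξ s) (jacOfSym Nbar Q Y)) =ᶠ[nhds t]
          fun s => 2 * X s i j := by
        filter_upwards [hI.mem_nhds ht] with s hs
        rw [fderiv_lagrangian h, metric_eq_trace h, symOfJac_jacOfSym h hYs,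
          (isSymm_symOfJac h (hξ s hs)).eq, htr _ (isSymm_symOfJac h (hξ s hs)).eq]
      have h3 := (h2.hasDerivAt_iff.1 h1).const_mul 2⁻¹
      simpa using h3
    exact hasDerivAt_pi.2 fun i => hasDerivAt_pi.2 fun j => entry i j
  · intro hBI t ht η hη
    obtain ⟨hs, hd⟩ := hBI t ht
    rw [key t ht η hη]
    simp only [fderiv_lagrangian h, metric_eq_trace h]
    -- The velocity is replaced by its transpose to match the transpose of X in the trace form.
    rw [← transpose_blochIserles hN hs]
    have hT := hasDerivAt_linearMap (transposeLinearEquiv (Fin n) (Fin n) ℝ ℝ).toLinearMap hd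
    have hM := hasDerivAt_linearMap
      (LinearMap.mulRight ℝ (symOfJac Nbar Q η) : Matrix (Fin n) (Fin n) ℝ →ₗ[ℝ] _) hT
    exact hasDerivAt_linearMap (traceLinearMap (Fin n) ℝ ℝ) hM

end BlochIserles

/-! ### The first variation of the energy -/

namespace BlochIserles

section Partial

variable {E : Type*} [NormedAddCommGroup E] [NormedSpace ℝ E]

theorem hasDerivAt_partial_fst {G : ℝ × ℝ → E} {U : Set (ℝ × ℝ)} (hU : IsOpen U)
    (hG : ContDiffOn ℝ ∞ G U) {ε t : ℝ} (hz : (ε, t) ∈ U) :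
    HasDerivAt (fun e => G (e, t)) (fderiv ℝ G (ε, t) (1, 0)) ε :=
  (((hG.contDiffAt (hU.mem_nhds hz)).differentiableAt (by simp)).hasFDerivAt).comp_hasDerivAt ε
    ((hasDerivAt_id ε).prodMk (hasDerivAt_const ε t))

theorem hasDerivAt_partial_snd {G : ℝ × ℝ → E} {U : Set (ℝ × ℝ)} (hU : IsOpen U)
    (hG : ContDiffOn ℝ ∞ G U) {ε t : ℝ} (hz : (ε, t) ∈ U) :
    HasDerivAt (fun s => G (ε, s)) (fderiv ℝ G (ε, t) (0, 1)) t :=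
  (((hG.contDiffAt (hU.mem_nhds hz)).differentiableAt (by simp)).hasFDerivAt).comp_hasDerivAt t
    ((hasDerivAt_const t ε).prodMk (hasDerivAt_id t))

theorem contDiffOn_fderiv_apply {G : ℝ × ℝ → E} {U : Set (ℝ × ℝ)} (hU : IsOpen U)
    (hG : ContDiffOn ℝ ∞ G U) (w : ℝ × ℝ) : ContDiffOn ℝ ∞ (fun z => fderiv ℝ G z w) U :=
  (hG.fderiv_of_isOpen hU (by simp)).clm_apply contDiffOn_const

theorem fderiv_fderiv_swap {G : ℝ × ℝ → E} {U : Set (ℝ × ℝ)} (hU : IsOpen U)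
    (hG : ContDiffOn ℝ ∞ G U) {z : ℝ × ℝ} (hz : z ∈ U) (v w : ℝ × ℝ) :
    fderiv ℝ (fun z => fderiv ℝ G z v) z w = fderiv ℝ (fun z => fderiv ℝ G z w) z v := by
  have hd : DifferentiableAt ℝ (fderiv ℝ G) z :=
    ((hG.fderiv_of_isOpen (m := ∞) hU (by simp)).contDiffAt (hU.mem_nhds hz)).differentiableAt
      (by simp)
  have h : ∀ x : ℝ × ℝ, fderiv ℝ (fun z => fderiv ℝ G z x) z = (fderiv ℝ (fderiv ℝ G) z).flip x := by
    intro x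
    have := (hd.hasFDerivAt.clm_apply (hasFDerivAt_const x z)).fderiv
    rw [this]
    simp
  rw [h, h]
  exact ((hG.contDiffAt (hU.mem_nhds hz)).isSymmSndFDerivAt
    (by simpa using WithTop.coe_le_coe.2 (le_top (a := (2 : ℕ∞))))) w v

theorem hasDerivAt_integral_of_contDiffOn {f : ℝ × ℝ → ℝ} {I : Set ℝ} (hI : IsOpen I) {a b δ : ℝ}
    (hab : a < b) (hsub : Icc a b ⊆ I) (hδ : 0 < δ)
    (hf : ContDiffOn ℝ ∞ f (Ioo (-δ) δ ×ˢ I)) :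
    HasDerivAt (fun ε => ∫ t in a..b, f (ε, t)) (∫ t in a..b, fderiv ℝ f (0, t) (1, 0)) 0 := by
  have hU : IsOpen (Ioo (-δ) δ ×ˢ I) := isOpen_Ioo.prod hI
  have hf' := contDiffOn_fderiv_apply hU hf (1, 0)
  -- Halving δ gives a compact rectangle inside the domain, where ∂f/∂ε has a constant bound to
  -- dominate with.
  have hK : IsCompact (Icc (-(δ / 2)) (δ / 2) ×ˢ Icc a b) := isCompact_Icc.prod isCompact_Icc
  have hKU : Icc (-(δ / 2)) (δ / 2) ×ˢ Icc a b ⊆ Ioo (-δ) δ ×ˢ I :=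
    prod_mono (fun x hx => ⟨by linarith [hx.1], by linarith [hx.2]⟩) hsub
  obtain ⟨C, hC⟩ := hK.exists_bound_of_continuousOn (hf'.continuousOn.mono hKU)
  have hslice : ∀ g : ℝ × ℝ → ℝ, ContinuousOn g (Ioo (-δ) δ ×ˢ I) → ∀ ε ∈ Ioo (-δ) δ,
      ContinuousOn (fun t => g (ε, t)) (uIcc a b) := by
    intro g hg ε hε
    refine hg.comp (by fun_prop) fun t ht => ⟨hε, hsub ?_⟩
    rwa [uIcc_of_le hab.le] at ht
  have h0 : (0 : ℝ) ∈ Ioo (-δ) δ := ⟨by linarith, hδ⟩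
  refine (intervalIntegral.hasDerivAt_integral_of_dominated_loc_of_deriv_le
    (F := fun ε t => f (ε, t)) (F' := fun ε t => fderiv ℝ f (ε, t) (1, 0))
    (s := Ioo (-(δ / 2)) (δ / 2)) (bound := fun _ => C)
    (Ioo_mem_nhds (by linarith) (by linarith)) ?_ ?_ ?_ ?_ ?_ ?_).2
  · filter_upwards [Ioo_mem_nhds h0.1 h0.2] with ε hε
    exact (hslice f hf.continuousOn ε hε).intervalIntegrable.aestronglyMeasurable_restrict_uIoc
  · exact (hslice f hf.continuousOn 0 h0).intervalIntegrable
  · exact (hslice _ hf'.continuousOn 0 h0).intervalIntegrable.aestronglyMeasurable_restrict_uIoc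
  · refine Filter.Eventually.of_forall fun t ht ε hε => hC (ε, t) ⟨Ioo_subset_Icc_self hε, ?_⟩
    rw [← uIcc_of_le hab.le]
    exact uIoc_subset_uIcc ht
  · exact intervalIntegrable_const
  · refine Filter.Eventually.of_forall fun t ht ε hε =>
      hasDerivAt_partial_fst hU hf (hKU ⟨Ioo_subset_Icc_self hε, ?_⟩)
    rw [← uIcc_of_le hab.le]
    exact uIoc_subset_uIcc ht

end Partial

variable {m : ℕ} {J M : Matrix (Fin m) (Fin m) ℝ} {c : ℝ → Jac J} {I : Set ℝ}

theorem SmoothCurveOn.hasDerivAt (hc : SmoothCurveOn c I) (hI : IsOpen I) {t : ℝ} (ht : t ∈ I) :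
    HasDerivAt (fun s => coords (c s)) (deriv (fun s => coords (c s)) t) t :=
  (ContDiffAt.differentiableAt (ContDiffOn.contDiffAt hc (hI.mem_nhds ht)) (by simp)).hasDerivAt

theorem SmoothCurveOn.leftVelocity_mem (hdet : IsUnit J.det) (hJ : Jᵀ = -J)
    (hc : SmoothCurveOn c I) (hI : IsOpen I) {t : ℝ} (ht : t ∈ I) :
    leftVelocity c t ∈ jacAlgebra J := by
  rw [leftVelocity_eq hdet (hc.hasDerivAt hI ht)]
  exact leftForm_mem hdet hJ (tangent_of_hasDerivAt (hc.hasDerivAt hI ht))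

theorem SmoothCurveOn.contDiffOn_leftVelocity (hdet : IsUnit J.det)
    (hc : SmoothCurveOn c I) (hI : IsOpen I) : ContDiffOn ℝ ∞ (leftVelocity c) I := by
  have h : ContDiffOn ℝ ∞
      (fun t => leftForm J (coords (c t)) (deriv (fun s => coords (c s)) t)) I :=
    contDiffOn_leftForm hc (ContDiffOn.deriv_of_isOpen hc hI (by simp))
  exact h.congr fun t ht => leftVelocity_eq hdet (hc.hasDerivAt hI ht)

/-- The left-trivialized variation field of a family of curves. -/
noncomputable def variationField (γ : ℝ → ℝ → Jac J) (t : ℝ) : JacVec m :=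
  leftForm J (coords (γ 0 t)) (deriv (fun ε => coords (γ ε t)) 0)

theorem variationField_eq {γ : ℝ → ℝ → Jac J} {t : ℝ} {v : JacVec m}
    (h : HasDerivAt (fun ε => coords (γ ε t)) v 0) :
    variationField γ t = leftForm J (coords (γ 0 t)) v :=
  congrArg (leftForm J (coords (γ 0 t))) h.deriv

theorem IsVariation.contDiffOn_variationField {a b δ : ℝ} {γ : ℝ → ℝ → Jac J} (hI : IsOpen I)
    (hδ : 0 < δ) (hγ : IsVariation c I a b δ γ) : ContDiffOn ℝ ∞ (variationField γ) I := by
  have hU : IsOpen (Ioo (-δ) δ ×ˢ I) := isOpen_Ioo.prod hI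
  have h0 : (0 : ℝ) ∈ Ioo (-δ) δ := ⟨by linarith, hδ⟩
  have h1 : ContDiffOn ℝ ∞ (fun t : ℝ => ((0, t) : ℝ × ℝ)) I := by fun_prop
  have hm : MapsTo (fun t : ℝ => ((0, t) : ℝ × ℝ)) I (Ioo (-δ) δ ×ˢ I) := fun t ht => ⟨h0, ht⟩
  have h := contDiffOn_leftForm (J := J) (hγ.smooth.comp h1 hm)
    ((contDiffOn_fderiv_apply hU hγ.smooth (1, 0)).comp h1 hm)
  exact h.congr fun t ht => variationField_eq (hasDerivAt_partial_fst hU hγ.smooth (hm ht))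

theorem IsVariation.variationField_mem {a b δ : ℝ} {γ : ℝ → ℝ → Jac J} (hdet : IsUnit J.det)
    (hJ : Jᵀ = -J) (hI : IsOpen I) (hδ : 0 < δ) (hγ : IsVariation c I a b δ γ) {t : ℝ}
    (ht : t ∈ I) : variationField γ t ∈ jacAlgebra J := by
  have hU : IsOpen (Ioo (-δ) δ ×ˢ I) := isOpen_Ioo.prod hI
  have h0 : (0 : ℝ) ∈ Ioo (-δ) δ := ⟨by linarith, hδ⟩
  have h := hasDerivAt_partial_fst hU hγ.smooth (ε := 0) (t := t) ⟨h0, ht⟩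
  have h2 := tangent_of_hasDerivAt (c := fun ε => γ ε t) h
  rw [variationField_eq h]
  exact leftForm_mem hdet hJ h2

theorem variationField_eq_zero {δ t : ℝ} {γ : ℝ → ℝ → Jac J} {p : Jac J}
    (hδ : 0 < δ) (h : ∀ ε ∈ Ioo (-δ) δ, γ ε t = p) : variationField γ t = 0 := by
  have h1 : (fun ε => coords (γ ε t)) =ᶠ[nhds 0] fun _ => coords p := by
    filter_upwards [Ioo_mem_nhds (show -δ < 0 by linarith) hδ] with ε hε
    rw [h ε hε]
  rw [variationField_eq (h1.hasDerivAt_iff.2 (hasDerivAt_const 0 _)), map_zero]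

/-- The derivative of the energy, before the integration by parts. -/
theorem IsVariation.hasDerivAt_action_aux {ℓ : JacVec m → ℝ} {a b δ : ℝ} {γ : ℝ → ℝ → Jac J}
    (hdet : IsUnit J.det) (hJ : Jᵀ = -J) (hℓ : ∀ ξ, ℓ ξ = 1 / 2 * metric M ξ ξ)
    (hI : IsOpen I) (hab : a < b) (hsub : Icc a b ⊆ I) (hδ : 0 < δ)
    (hγ : IsVariation c I a b δ γ) :
    HasDerivAt (fun ε => action ℓ a b (γ ε))
      (∫ t in a..b, metric M (leftVelocity c t)
        (deriv (variationField γ) t + jacBracket J (leftVelocity c t) (variationField γ t))) 0 := by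
  set F : ℝ × ℝ → JacVec m := fun z => coords (γ z.1 z.2) with hFdef
  have hF : ContDiffOn ℝ ∞ F (Ioo (-δ) δ ×ˢ I) := hγ.smooth
  have hU : IsOpen (Ioo (-δ) δ ×ˢ I) := isOpen_Ioo.prod hI
  have h0 : (0 : ℝ) ∈ Ioo (-δ) δ := ⟨by linarith, hδ⟩
  have hT := contDiffOn_fderiv_apply hU hF (0, 1)
  have hE := contDiffOn_fderiv_apply hU hF (1, 0)
  set Ξ : ℝ × ℝ → JacVec m := fun z => leftForm J (F z) (fderiv ℝ F z (0, 1)) with hΞdef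
  have hΞ : ContDiffOn ℝ ∞ Ξ (Ioo (-δ) δ ×ˢ I) := contDiffOn_leftForm hF hT
  have hvel : ∀ ε ∈ Ioo (-δ) δ, ∀ t ∈ I, leftVelocity (γ ε) t = Ξ (ε, t) := fun ε hε t ht =>
    leftVelocity_eq hdet (hasDerivAt_partial_snd hU hF ⟨hε, ht⟩)
  have hvc : ∀ t ∈ I, leftVelocity c t = Ξ (0, t) := by
    intro t ht
    rw [← hvel 0 h0 t ht]
    have hg : HasDerivAt (fun s => coords (γ 0 s)) _ t := hasDerivAt_partial_snd hU hF ⟨h0, ht⟩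
    have he : (fun s => coords (c s)) =ᶠ[nhds t] fun s => coords (γ 0 s) := by
      filter_upwards [hI.mem_nhds ht] with s hs
      rw [hγ.base s hs]
    rw [leftVelocity_eq hdet hg, leftVelocity_eq hdet (hg.congr_of_eventuallyEq he),
      hγ.base t ht]
  set f : ℝ × ℝ → ℝ := fun z => 1 / 2 * metric M (Ξ z) (Ξ z) with hfdef
  have hf : ContDiffOn ℝ ∞ f (Ioo (-δ) δ ×ˢ I) :=
    contDiffOn_const.mul (contDiffOn_bilinear (metric M) hΞ hΞ)
  have hsubI : ∀ t ∈ uIcc a b, t ∈ I := fun t ht => hsub (by rwa [uIcc_of_le hab.le] at ht)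
  have key := hasDerivAt_integral_of_contDiffOn hI hab hsub hδ hf
  have hact : (fun ε => action ℓ a b (γ ε)) =ᶠ[nhds 0] fun ε => ∫ t in a..b, f (ε, t) := by
    filter_upwards [Ioo_mem_nhds h0.1 h0.2] with ε hε
    refine intervalIntegral.integral_congr fun t ht => ?_
    simp only [hℓ, hvel ε hε t (hsubI t ht), hfdef]
  refine (key.congr_of_eventuallyEq hact).congr_deriv
    (intervalIntegral.integral_congr fun t ht => ?_)
  -- Here u + D is ∂_ε of the velocity and v + D' is ∂_t of the variation field. D = D' by equality
  -- of mixed partials, and u - v is the Maurer–Cartan bracket.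
  have algebra : ∀ x u v D D' h : JacVec m, D' = D → u - v = jacBracket J x h →
      1 / 2 * (metric M (u + D) x + metric M x (u + D)) =
        metric M x (v + D' + jacBracket J x h) := by
    intro x u v D D' h hD hj
    rw [hD, ← hj, metric_comm M (u + D), show v + D + (u - v) = u + D by abel]
    ring
  have htI := hsubI t ht
  have hz : ((0, t) : ℝ × ℝ) ∈ Ioo (-δ) δ ×ˢ I := ⟨h0, htI⟩
  have hΞ' := hasDerivAt_leftForm (J := J) (hasDerivAt_partial_fst hU hF hz)
    (hasDerivAt_partial_fst hU hT hz)
  have hη' := hasDerivAt_leftForm (J := J) (hasDerivAt_partial_snd hU hF hz)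
    (hasDerivAt_partial_snd hU hE hz)
  have hηe : ∀ s ∈ I, variationField γ s = leftForm J (F (0, s)) (fderiv ℝ F (0, s) (1, 0)) := by
    intro s hs
    exact variationField_eq (hasDerivAt_partial_fst hU hF (ε := 0) (t := s) ⟨h0, hs⟩)
  have hη : HasDerivAt (variationField γ) _ t := hη'.congr_of_eventuallyEq (by
    filter_upwards [hI.mem_nhds htI] with s hs
    exact hηe s hs)
  have hmc := leftBilin_sub hdet hJ (γ 0 t)
    (tangent_of_hasDerivAt (c := fun ε => γ ε t) (hasDerivAt_partial_fst hU hF hz))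
    (tangent_of_hasDerivAt (c := fun s => γ 0 s) (hasDerivAt_partial_snd hU hF hz))
  set ζ : JacVec m := leftBilin J (fderiv ℝ F (0, t) (1, 0)) (fderiv ℝ F (0, t) (0, 1)) +
    leftForm J (F (0, t)) (fderiv ℝ (fun z => fderiv ℝ F z (0, 1)) (0, t) (1, 0))
  have hd : HasDerivAt (fun e => f (e, t))
      (1 / 2 * (metric M ζ (Ξ (0, t)) + metric M (Ξ (0, t)) ζ)) 0 :=
    (hasDerivAt_bilinear (metric M) hΞ' hΞ').const_mul (1 / 2)
  have hηd : deriv (variationField γ) t = _ := hη.deriv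
  rw [(hasDerivAt_partial_fst hU hf hz).unique hd, hηd, hvc t htI, hηe t htI]
  exact algebra _ _ _ _ _ _ (congrArg (leftForm J (F (0, t)))
    (fderiv_fderiv_swap hU hF hz (1, 0) (0, 1))) hmc

theorem jacBracket_smul (r : ℝ) (ξ η : JacVec m) :
    jacBracket J ξ (r • η) = r • jacBracket J ξ η := by
  refine Prod.ext ?_ (Prod.ext ?_ ?_)
  · simp [jacBracket, smul_sub]
  · simp [jacBracket, mulVec_smul, smul_mulVec, smul_sub]
  · simp [jacBracket, form_smul_right]

/-- The Lie bracket as a bilinear map. -/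
def bracketBilin (J : Matrix (Fin m) (Fin m) ℝ) : JacVec m →ₗ[ℝ] JacVec m →ₗ[ℝ] JacVec m :=
  LinearMap.mk₂ ℝ (jacBracket J)
    (fun ξ ξ' η => by
      refine Prod.ext ?_ (Prod.ext ?_ ?_)
      · simp only [jacBracket, Prod.fst_add, Matrix.add_mul, Matrix.mul_add]
        abel
      · simp only [jacBracket, Prod.fst_add, Prod.snd_add, add_mulVec, mulVec_add]
        abel
      · simp [jacBracket, form_add_left])
    (fun r ξ η => by
      refine Prod.ext ?_ (Prod.ext ?_ ?_)
      · simp [jacBracket, smul_sub]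
      · simp [jacBracket, mulVec_smul, smul_mulVec, smul_sub]
      · simp [jacBracket, form_smul_left])
    (fun ξ η η' => by
      refine Prod.ext ?_ (Prod.ext ?_ ?_)
      · simp only [jacBracket, Prod.fst_add, Matrix.add_mul, Matrix.mul_add]
        abel
      · simp only [jacBracket, Prod.fst_add, Prod.snd_add, add_mulVec, mulVec_add]
        abel
      · simp [jacBracket, form_add_right])
    jacBracket_smul

/-- The first variation formula. -/
theorem IsVariation.hasDerivAt_action {ℓ : JacVec m → ℝ} {a b δ : ℝ} {γ : ℝ → ℝ → Jac J}
    (hdet : IsUnit J.det) (hJ : Jᵀ = -J) (hℓ : ∀ ξ, ℓ ξ = 1 / 2 * metric M ξ ξ)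
    (hI : IsOpen I) (hc : SmoothCurveOn c I) (hab : a < b) (hsub : Icc a b ⊆ I) (hδ : 0 < δ)
    (hγ : IsVariation c I a b δ γ) :
    HasDerivAt (fun ε => action ℓ a b (γ ε))
      (∫ t in a..b, (metric M (leftVelocity c t) (jacBracket J (leftVelocity c t)
        (variationField γ t)) - metric M (deriv (leftVelocity c) t) (variationField γ t))) 0 := by
  refine (hγ.hasDerivAt_action_aux hdet hJ hℓ hI hab hsub hδ).congr_deriv ?_
  set ξ := leftVelocity c
  set η := variationField γ
  have hξ : ContDiffOn ℝ ∞ ξ I := hc.contDiffOn_leftVelocity hdet hI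
  have hη : ContDiffOn ℝ ∞ η I := hγ.contDiffOn_variationField hI hδ
  have hξ' : ContDiffOn ℝ ∞ (deriv ξ) I := hξ.deriv_of_isOpen hI (by simp)
  have hη' : ContDiffOn ℝ ∞ (deriv η) I := hη.deriv_of_isOpen hI (by simp)
  have hu : uIcc a b ⊆ I := by rwa [uIcc_of_le hab.le]
  have hint : ∀ f g : ℝ → JacVec m, ContDiffOn ℝ ∞ f I → ContDiffOn ℝ ∞ g I →
      IntervalIntegrable (fun t => metric M (f t) (g t)) MeasureTheory.volume a b :=
    fun f g hf hg => ((contDiffOn_bilinear (metric M) hf hg).continuousOn.mono hu).intervalIntegrable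
  have hbr : ContDiffOn ℝ ∞ (fun t => jacBracket J (ξ t) (η t)) I :=
    contDiffOn_bilinear (bracketBilin J) hξ hη
  have hder : ∀ t ∈ uIcc a b, HasDerivAt (fun s => metric M (ξ s) (η s))
      (metric M (deriv ξ t) (η t) + metric M (ξ t) (deriv η t)) t := by
    intro t ht
    have h1 := ((hξ.contDiffAt (hI.mem_nhds (hu ht))).differentiableAt (by simp)).hasDerivAt
    have h2 := ((hη.contDiffAt (hI.mem_nhds (hu ht))).differentiableAt (by simp)).hasDerivAt
    exact hasDerivAt_bilinear (metric M) h1 h2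
  -- Integration by parts; the boundary terms vanish because the end points are fixed.
  have hparts := intervalIntegral.integral_eq_sub_of_hasDerivAt hder
    ((hint _ _ hξ' hη).add (hint _ _ hξ hη'))
  have ha : η a = 0 := variationField_eq_zero hδ hγ.left
  have hb : η b = 0 := variationField_eq_zero hδ hγ.right
  rw [ha, hb, map_zero, map_zero, sub_zero,
    intervalIntegral.integral_add (hint _ _ hξ' hη) (hint _ _ hξ hη')] at hparts
  simp only [map_add]
  rw [intervalIntegral.integral_add (hint _ _ hξ hη') (hint _ _ hξ hbr),
    intervalIntegral.integral_sub (hint _ _ hξ hbr) (hint _ _ hξ' hη)]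
  linarith

end BlochIserles

/-! ### Variations with a prescribed field and the geodesic equation -/

namespace BlochIserles

variable {m : ℕ} {J M : Matrix (Fin m) (Fin m) ℝ} {c : ℝ → Jac J} {I : Set ℝ}

/-- The product of matrices and vectors as a bilinear map. -/
def mulVecBilinear (m : ℕ) :
    Matrix (Fin m) (Fin m) ℝ →ₗ[ℝ] (Fin m → ℝ) →ₗ[ℝ] (Fin m → ℝ) :=
  LinearMap.mk₂ ℝ (fun A v => A *ᵥ v) (fun A B v => add_mulVec A B v)
    (fun r A v => smul_mulVec r A v) (fun A u v => mulVec_add A u v)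
    (fun r A v => mulVec_smul A r v)

theorem contDiffOn_coords_mul {H : Type*} [NormedAddCommGroup H] [NormedSpace ℝ H]
    {f g : H → Jac J} {s : Set H} (hf : ContDiffOn ℝ ∞ (fun x => coords (f x)) s)
    (hg : ContDiffOn ℝ ∞ (fun x => coords (g x)) s) :
    ContDiffOn ℝ ∞ (fun x => coords (f x * g x)) s := by
  simp only [coords_mul]
  have hw : ContDiffOn ℝ ∞ (fun x => (coords (f x)).1 *ᵥ (coords (g x)).2.1) s :=
    contDiffOn_bilinear (mulVecBilinear m) hf.fst hg.snd.fst
  have hb : ContDiffOn ℝ ∞ (fun x => form J (coords (f x)).2.1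
      ((coords (f x)).1 *ᵥ (coords (g x)).2.1)) s :=
    contDiffOn_bilinear (formBilin J) hf.snd.fst hw
  exact (hf.fst.mul hg.fst).prodMk ((hf.snd.fst.add hw).prodMk
    ((hf.snd.snd.add hg.snd.snd).add (contDiffOn_const.mul hb)))

/-- Aᵀ = J(-A)J⁻¹, so exp(A)ᵀ = J exp(-A) J⁻¹. -/
theorem exp_mem_symp (hdet : IsUnit J.det) {A : Matrix (Fin m) (Fin m) ℝ}
    (hA : Aᵀ * J + J * A = 0) :
    (NormedSpace.exp A)ᵀ * J * NormedSpace.exp A = J := by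
  have h1 : Aᵀ = J * (-A) * J⁻¹ := by
    rw [Matrix.mul_neg, ← eq_neg_of_add_eq_zero_left hA, Matrix.mul_assoc, mul_nonsing_inv _ hdet,
      Matrix.mul_one]
  rw [← Matrix.exp_transpose, h1, Matrix.exp_conj _ _ ((isUnit_iff_isUnit_det J).2 hdet),
    Matrix.mul_assoc _ J⁻¹, nonsing_inv_mul _ hdet, Matrix.mul_one, Matrix.exp_neg, Matrix.mul_assoc,
    nonsing_inv_mul _ ((isUnit_iff_isUnit_det _).1 (Matrix.isUnit_exp A)), Matrix.mul_one]

/-- The point of the Jacobi group with given coordinates. -/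
theorem exists_coords_eq (hdet : IsUnit J.det) {p : JacVec m} (hp : p.1ᵀ * J * p.1 = J) :
    ∃ q : Jac J, coords q = p := by
  have h : J⁻¹ * p.1ᵀ * J * p.1 = 1 := by
    rw [Matrix.mul_assoc, Matrix.mul_assoc, ← Matrix.mul_assoc p.1ᵀ, hp, nonsing_inv_mul _ hdet]
  exact ⟨⟨⟨p.2.1, p.2.2⟩, ⟨⟨p.1, J⁻¹ * p.1ᵀ * J, mul_eq_one_comm.1 h, h⟩, hp⟩⟩, rfl⟩

theorem coords_injective : Function.Injective (coords (J := J)) := by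
  intro p q h
  obtain ⟨h1, h2⟩ := Prod.ext_iff.1 h
  obtain ⟨h2, h3⟩ := Prod.ext_iff.1 h2
  exact SemidirectProduct.ext (Heis.ext h2 h3) (Subtype.ext (Units.ext h1))

/-- A smooth curve through the identity with given velocity. -/
theorem exists_curve (hdet : IsUnit J.det) {η : JacVec m} (hη : η ∈ jacAlgebra J) :
    ∃ h : ℝ → Jac J, h 0 = 1 ∧ ContDiff ℝ ∞ (fun s => coords (h s)) ∧
      HasDerivAt (fun s => coords (h s)) η 0 := by
  -- Only the matrix component is constrained, so the other two may be straight lines. The curve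
  -- need not be a one-parameter subgroup: only its velocity at 0 matters.
  have hex : ∀ s : ℝ, ∃ q : Jac J, coords q =
      (NormedSpace.exp (s • η.1), s • η.2.1, s * η.2.2) := fun s =>
    exists_coords_eq hdet (exp_mem_symp hdet ((jacAlgebra J).smul_mem s hη))
  choose h hh using hex
  refine ⟨h, coords_injective ?_, ?_, ?_⟩
  · rw [hh, coords_one]
    simp [NormedSpace.exp_zero]
  · simp only [hh]
    have he : ContDiff ℝ ∞ (fun s : ℝ => NormedSpace.exp (s • η.1)) := by
      have : ContDiff ℝ ∞ (NormedSpace.exp : Matrix (Fin m) (Fin m) ℝ → _) :=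
        contDiff_iff_contDiffAt.2 fun x => (NormedSpace.exp_analytic (𝕂 := ℝ) x).contDiffAt
      exact this.comp (contDiff_id.smul contDiff_const)
    exact he.prodMk ((contDiff_id.smul contDiff_const).prodMk (contDiff_id.mul contDiff_const))
  · simp only [hh]
    have he : HasDerivAt (fun s : ℝ => NormedSpace.exp (s • η.1)) η.1 0 :=
      (hasDerivAt_exp_smul_const (𝕂 := ℝ) η.1 0).congr_deriv (by simp [NormedSpace.exp_zero])
    have h1 : HasDerivAt (fun s : ℝ => s • η.2.1) η.2.1 0 := by
      simpa using (hasDerivAt_id (0 : ℝ)).smul_const η.2.1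
    have h2 : HasDerivAt (fun s : ℝ => s * η.2.2) η.2.2 0 := by
      simpa using (hasDerivAt_id (0 : ℝ)).mul_const η.2.2
    exact he.prodMk (h1.prodMk h2)

theorem leftForm_one (hdet : IsUnit J.det) (v : JacVec m) :
    leftForm J (coords (1 : Jac J)) v = v := by
  rw [leftForm_apply, coords_one]
  simp [nonsing_inv_mul _ hdet, form]

/-- The variation of `c` in the direction of a vector of the Lie algebra multiplied by a function. -/
theorem exists_variation (hdet : IsUnit J.det) (hc : SmoothCurveOn c I)
    {a b : ℝ} {η : JacVec m} (hη : η ∈ jacAlgebra J) {φ : ℝ → ℝ} (hφ : ContDiff ℝ ∞ φ)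
    (ha : φ a = 0) (hb : φ b = 0) :
    ∃ γ : ℝ → ℝ → Jac J, IsVariation c I a b 1 γ ∧ ∀ t, variationField γ t = φ t • η := by
  obtain ⟨h, h0, hs, hd⟩ := exists_curve hdet hη
  -- Multiplying c(t) on the right makes the left-trivialized field independent of c: it is φ(t)
  -- times the velocity of h at 0.
  refine ⟨fun ε t => c t * h (ε * φ t), ⟨?_, ?_, ?_, ?_⟩, ?_⟩
  · refine contDiffOn_coords_mul (hc.comp contDiff_snd.contDiffOn fun z hz => hz.2) ?_
    exact (hs.comp (contDiff_fst.mul (hφ.comp contDiff_snd))).contDiffOn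
  · intro t _
    simp [h0]
  · intro ε _
    simp [ha, h0]
  · intro ε _
    simp [hb, h0]
  · intro t
    have h1 : HasDerivAt (fun ε : ℝ => coords (h (ε * φ t))) (φ t • η) 0 := by
      have h2 : HasDerivAt (fun ε : ℝ => ε * φ t) (φ t) 0 := by
        simpa using (hasDerivAt_id (0 : ℝ)).mul_const (φ t)
      have h3 : HasDerivAt (fun s => coords (h s)) η (0 * φ t) := by
        rw [zero_mul]
        exact hd
      exact HasDerivAt.scomp (h := fun ε : ℝ => ε * φ t) (0 : ℝ) h3 h2
    have h3 : ContDiffOn ℝ ∞ (fun ε : ℝ => coords (c t * h (ε * φ t))) univ := by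
      refine contDiffOn_coords_mul contDiffOn_const ?_
      exact (hs.comp (contDiff_id.mul contDiff_const)).contDiffOn
    have h4 : HasDerivAt (fun ε : ℝ => coords (c t * h (ε * φ t))) _ 0 :=
      ((contDiffOn_univ.1 h3).differentiable (by simp) 0).hasDerivAt
    rw [variationField_eq h4, ← leftVelocity_eq hdet h4,
      leftVelocity_mul_left (c t) (fun ε => h (ε * φ t)), leftVelocity_eq hdet h1]
    simp only [zero_mul, h0, leftForm_one hdet]

theorem eulerPoincareOn_iff_deriv {ℓ : JacVec m → ℝ} {ξ : ℝ → JacVec m}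
    (hfd : ∀ ξ η, fderiv ℝ ℓ ξ η = metric M ξ η) (hI : IsOpen I) (hξ : ContDiffOn ℝ ∞ ξ I) :
    EulerPoincareOn J ℓ ξ I ↔ ∀ t ∈ I, ∀ η ∈ jacAlgebra J,
      metric M (ξ t) (jacBracket J (ξ t) η) = metric M (deriv ξ t) η := by
  have hd : ∀ t ∈ I, ∀ η, HasDerivAt (fun s => metric M (ξ s) η) (metric M (deriv ξ t) η) t := by
    intro t ht η
    have h1 := ((hξ.contDiffAt (hI.mem_nhds ht)).differentiableAt (by simp)).hasDerivAt
    exact hasDerivAt_linearMap ((metric M).flip η) h1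
  simp only [EulerPoincareOn, hfd]
  refine forall₂_congr fun t ht => forall₂_congr fun η _ => ⟨fun h => h.unique (hd t ht η), ?_⟩
  intro h
  rw [h]
  exact hd t ht η

/-- The fundamental lemma of the calculus of variations, with test fields φη for constant η and φ
supported in a small interval around t. Conversely, the pointwise equation makes the integrand of
the first variation vanish. -/
theorem isGeodesicOn_iff {ℓ : JacVec m → ℝ} (hdet : IsUnit J.det) (hJ : Jᵀ = -J)
    (hℓ : ∀ ξ, ℓ ξ = 1 / 2 * metric M ξ ξ) (hI : IsOpen I) (hc : SmoothCurveOn c I) :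
    IsGeodesicOn ℓ c I ↔ ∀ t ∈ I, ∀ η ∈ jacAlgebra J,
      metric M (leftVelocity c t) (jacBracket J (leftVelocity c t) η) =
        metric M (deriv (leftVelocity c) t) η := by
  constructor
  · rintro ⟨-, hgeo⟩ t ht η hη
    obtain ⟨r, hr, hball⟩ := Metric.isOpen_iff.1 hI t ht
    have hsub : Icc (t - r / 2) (t + r / 2) ⊆ I := fun s hs => hball (by
      rw [Metric.mem_ball, Real.dist_eq, abs_lt]
      constructor <;> linarith [hs.1, hs.2])
    set a := t - r / 2
    set b := t + r / 2
    have hab : a < b := by simp only [a, b]; linarith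
    set ξ := leftVelocity c
    have hξ : ContDiffOn ℝ ∞ ξ I := hc.contDiffOn_leftVelocity hdet hI
    have hξ' : ContDiffOn ℝ ∞ (deriv ξ) I := hξ.deriv_of_isOpen hI (by simp)
    set f : ℝ → ℝ := fun s => metric M (ξ s) (jacBracket J (ξ s) η) - metric M (deriv ξ s) η
    have hf : ContinuousOn f I := by
      have h1 : ContDiffOn ℝ ∞ (fun s => metric M (ξ s) (jacBracket J (ξ s) η)) I :=
        contDiffOn_bilinear (metric M) hξ (contDiffOn_linearMap ((bracketBilin J).flip η) hξ)
      have h2 : ContDiffOn ℝ ∞ (fun s => metric M (deriv ξ s) η) I :=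
        contDiffOn_linearMap ((metric M).flip η) hξ'
      exact h1.continuousOn.sub h2.continuousOn
    have hU : Ioo a b ⊆ I := Ioo_subset_Icc_self.trans hsub
    have hae : ∀ᵐ s, s ∈ Ioo a b → f s = 0 := by
      refine isOpen_Ioo.ae_eq_zero_of_integral_contDiff_smul_eq_zero
        ((hf.mono hU).locallyIntegrableOn measurableSet_Ioo) fun φ hφ _ hsupp => ?_
      have hφ0 : ∀ s, s ∉ Ioo a b → φ s = 0 := fun s hs =>
        image_eq_zero_of_notMem_tsupport fun h => hs (hsupp h)
      obtain ⟨γ, hγ, hfield⟩ := exists_variation hdet hc hη hφ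
        (hφ0 a fun h => lt_irrefl _ h.1) (hφ0 b fun h => lt_irrefl _ h.2)
      have h0 := (hγ.hasDerivAt_action hdet hJ hℓ hI hc hab hsub one_pos).unique
        (hgeo a b hab hsub 1 one_pos γ hγ)
      rw [← h0, ← intervalIntegral.integral_eq_integral_of_support_subset (a := a) (b := b)]
      · refine intervalIntegral.integral_congr fun s _ => ?_
        simp only [hfield, jacBracket_smul, map_smul, smul_eq_mul, f]
        ring
      · intro s hs
        by_contra h
        refine hs ?_
        simp only
        rw [hφ0 s fun h' => h (Ioo_subset_Ioc_self h'), zero_smul]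
    -- Continuity upgrades vanishing almost everywhere to vanishing at every point, in particular at
    -- t.
    have heq := MeasureTheory.Measure.eqOn_open_of_ae_eq (f := f) (g := fun _ => (0 : ℝ))
      ((MeasureTheory.ae_restrict_iff' measurableSet_Ioo).2 hae) isOpen_Ioo (hf.mono hU)
      continuousOn_const
    have htab : t ∈ Ioo a b := by
      simp only [a, b]
      constructor <;> linarith
    exact sub_eq_zero.1 (heq htab)
  · intro h
    refine ⟨hc, fun a b hab hsub δ hδ γ hγ => ?_⟩
    refine (hγ.hasDerivAt_action hdet hJ hℓ hI hc hab hsub hδ).congr_deriv ?_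
    rw [← intervalIntegral.integral_zero (a := a) (b := b) (μ := MeasureTheory.volume)]
    refine intervalIntegral.integral_congr fun t ht => ?_
    have htI : t ∈ I := hsub (by rwa [uIcc_of_le hab.le] at ht)
    exact sub_eq_zero.2 (h t htI _ (hγ.variationField_mem hdet hJ hI hδ htI))

end BlochIserles

/-! ### Linear differential equations and reconstruction of the curve -/

namespace BlochIserles

section LinearODE

variable {E : Type*} [NormedAddCommGroup E] [NormedSpace ℝ E] {I : Set ℝ} {t₀ : ℝ}

theorem hasDerivAt_integral_of_continuousOn [CompleteSpace E] (hI : IsOpen I)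
    (hI' : I.OrdConnected) (ht₀ : t₀ ∈ I) {V : ℝ → E} (hV : ContinuousOn V I) {t : ℝ} (ht : t ∈ I) :
    HasDerivAt (fun t => ∫ s in t₀..t, V s) (V t) t :=
  intervalIntegral.integral_hasDerivAt_right
    (hV.mono (hI'.uIcc_subset ht₀ ht)).intervalIntegrable
    (hV.stronglyMeasurableAtFilter hI t ht) (hV.continuousAt (hI.mem_nhds ht))

/-- Bootstrapping: if the velocity is as regular as the solution, each step gains one derivative. -/
theorem contDiffOn_of_hasDerivAt (hI : IsOpen I) {x V : ℝ → E}
    (hx : ∀ t ∈ I, HasDerivAt x (V t) t)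
    (hV : ∀ n : ℕ, ContDiffOn ℝ n x I → ContDiffOn ℝ n V I) : ContDiffOn ℝ ∞ x I := by
  rw [contDiffOn_infty]
  intro n
  induction n with
  | zero =>
    exact contDiffOn_zero.2 fun t ht => (hx t ht).continuousAt.continuousWithinAt
  | succ n ih =>
    push_cast
    rw [contDiffOn_succ_iff_deriv_of_isOpen hI]
    refine ⟨fun t ht => (hx t ht).differentiableAt.differentiableWithinAt, by simp, ?_⟩
    exact (hV n ih).congr fun t ht => (hx t ht).deriv

variable {R : Type*} [NormedRing R] [NormedAlgebra ℝ R]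

/-- The terms of the Picard series of the linear equation `ẋ = x A`. -/
noncomputable def picardTerm (A : ℝ → R) (t₀ : ℝ) (x₀ : R) : ℕ → ℝ → R
  | 0 => fun _ => x₀
  | n + 1 => fun t => ∫ s in t₀..t, picardTerm A t₀ x₀ n s * A s

variable {A : ℝ → R} (x₀ : R)

theorem norm_picardTerm_le {S : Set ℝ} (hS : S.OrdConnected) (ht₀ : t₀ ∈ S) {K : ℝ}
    (hK : ∀ t ∈ S, ‖A t‖ ≤ K) (n : ℕ) : ∀ t ∈ S, ‖picardTerm A t₀ x₀ n t‖ ≤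
      ‖x₀‖ * ((K * |t - t₀|) ^ n / n.factorial) := by
  have hK0 : 0 ≤ K := (norm_nonneg _).trans (hK t₀ ht₀)
  induction n with
  | zero => intro t _; simp [picardTerm]
  | succ n ih =>
    intro t ht
    have hb : ∀ᵐ s ∂(MeasureTheory.volume.restrict (uIoc t₀ t)),
        ‖picardTerm A t₀ x₀ n s * A s‖ ≤ ‖x₀‖ * (K ^ (n + 1) / n.factorial) * |s - t₀| ^ n := by
      refine (MeasureTheory.ae_restrict_iff' measurableSet_uIoc).2 (Filter.Eventually.of_forall
        fun s hs => ?_)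
      have hsS : s ∈ S := hS.uIcc_subset ht₀ ht (uIoc_subset_uIcc hs)
      calc ‖picardTerm A t₀ x₀ n s * A s‖ ≤ ‖picardTerm A t₀ x₀ n s‖ * ‖A s‖ := norm_mul_le _ _
        _ ≤ ‖x₀‖ * ((K * |s - t₀|) ^ n / n.factorial) * K :=
          mul_le_mul (ih s hsS) (hK s hsS) (norm_nonneg _) (by positivity)
        _ = _ := by rw [mul_pow]; ring
    refine (intervalIntegral.norm_integral_le_abs_of_norm_le hb
      (Continuous.intervalIntegrable (by fun_prop) _ _)).trans (le_of_eq ?_)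
    rw [intervalIntegral.integral_const_mul, abs_mul, intervalIntegral.abs_intervalIntegral_eq,
      integral_pow_abs_sub_uIoc, abs_of_nonneg (by positivity), abs_of_nonneg (by positivity),
      mul_pow, Nat.factorial_succ]
    push_cast
    field_simp

variable [CompleteSpace R]

theorem picardTerm_facts (hI : IsOpen I) (hI' : I.OrdConnected) (ht₀ : t₀ ∈ I)
    (hA : ContinuousOn A I) (n : ℕ) : ContinuousOn (picardTerm A t₀ x₀ n) I ∧
      ∀ t ∈ I, HasDerivAt (picardTerm A t₀ x₀ (n + 1)) (picardTerm A t₀ x₀ n t * A t) t := by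
  induction n with
  | zero =>
    exact ⟨continuousOn_const, fun t ht =>
      hasDerivAt_integral_of_continuousOn hI hI' ht₀ (continuousOn_const.mul hA) ht⟩
  | succ n ih =>
    have h : ContinuousOn (picardTerm A t₀ x₀ (n + 1)) I := fun t ht =>
      (ih.2 t ht).continuousAt.continuousWithinAt
    exact ⟨h, fun t ht => hasDerivAt_integral_of_continuousOn hI hI' ht₀ (h.mul hA) ht⟩

/-- Linear equations do not blow up: the factorial bound makes the Picard series and its termwise
derivative converge uniformly on compact subintervals. The single formula serves all of I, so no
local solutions are glued. -/
theorem exists_linear_ode (hI : IsOpen I) (hI' : I.OrdConnected) (ht₀ : t₀ ∈ I)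
    (hA : ContinuousOn A I) :
    ∃ x : ℝ → R, x t₀ = x₀ ∧ ∀ t ∈ I, HasDerivAt x (x t * A t) t := by
  refine ⟨fun t => ∑' n, picardTerm A t₀ x₀ n t, ?_, ?_⟩
  · change ∑' n, picardTerm A t₀ x₀ n t₀ = x₀
    rw [tsum_eq_single 0]
    · rfl
    · intro n hn
      obtain ⟨k, rfl⟩ := Nat.exists_eq_succ_of_ne_zero hn
      exact intervalIntegral.integral_same
  · intro t ht
    obtain ⟨α, β, hsub, h0, h1⟩ : ∃ α β, Icc α β ⊆ I ∧ t₀ ∈ Ioo α β ∧ t ∈ Ioo α β := by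
      have hmin : min t₀ t ∈ I := by rcases min_choice t₀ t with h | h <;> rwa [h]
      have hmax : max t₀ t ∈ I := by rcases max_choice t₀ t with h | h <;> rwa [h]
      obtain ⟨r, hr, hr'⟩ := Metric.isOpen_iff.1 hI _ hmin
      obtain ⟨q, hq, hq'⟩ := Metric.isOpen_iff.1 hI _ hmax
      have hα : min t₀ t - r / 2 ∈ I := hr' (by
        rw [Metric.mem_ball, Real.dist_eq, abs_lt]; constructor <;> linarith)
      have hβ : max t₀ t + q / 2 ∈ I := hq' (by
        rw [Metric.mem_ball, Real.dist_eq, abs_lt]; constructor <;> linarith)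
      have e1 := min_le_left t₀ t
      have e2 := min_le_right t₀ t
      have e3 := le_max_left t₀ t
      have e4 := le_max_right t₀ t
      exact ⟨_, _, hI'.out hα hβ, ⟨by linarith, by linarith⟩, ⟨by linarith, by linarith⟩⟩
    obtain ⟨K, hK⟩ := isCompact_Icc.exists_bound_of_continuousOn (hA.mono hsub)
    have hK0 : 0 ≤ K := (norm_nonneg _).trans (hK t₀ (Ioo_subset_Icc_self h0))
    have hle : ∀ n, ∀ s ∈ Ioo α β, ‖picardTerm A t₀ x₀ n s‖ ≤
        ‖x₀‖ * ((K * (β - α)) ^ n / n.factorial) := by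
      intro n s hs
      refine (norm_picardTerm_le x₀ ordConnected_Icc (Ioo_subset_Icc_self h0) hK n s
        (Ioo_subset_Icc_self hs)).trans ?_
      have : |s - t₀| ≤ β - α := abs_le.2 ⟨by linarith [hs.1, h0.2], by linarith [hs.2, h0.1]⟩
      gcongr
    have hsum : Summable fun n : ℕ => ‖x₀‖ * ((K * (β - α)) ^ n / n.factorial) :=
      (Real.summable_pow_div_factorial _).mul_left _
    have hterm : ∀ s ∈ Ioo α β, Summable fun n => picardTerm A t₀ x₀ n s := fun s hs =>
      Summable.of_norm_bounded hsum fun n => hle n s hs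
    -- The initial term is constant, and each later one differentiates to its predecessor times A;
    -- this shift reproduces the equation after summation.
    set d : ℕ → ℝ → R := fun n s => Nat.casesOn n 0 fun k => picardTerm A t₀ x₀ k s * A s with hd
    set u : ℕ → ℝ := fun n => Nat.casesOn n 0 fun k =>
      ‖x₀‖ * ((K * (β - α)) ^ k / k.factorial) * K with hu
    have hus : Summable u := (summable_nat_add_iff 1).1 (hsum.mul_right K)
    have hder := hasDerivAt_tsum_of_isPreconnected (g := picardTerm A t₀ x₀) (g' := d) hus
      isOpen_Ioo isPreconnected_Ioo (fun n s hs => by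
        cases n with
        | zero => exact hasDerivAt_const s x₀
        | succ k => exact (picardTerm_facts x₀ hI hI' ht₀ hA k).2 s (hsub (Ioo_subset_Icc_self hs)))
      (fun n s hs => by
        cases n with
        | zero => simp [hd, hu]
        | succ k =>
          refine (norm_mul_le _ _).trans (mul_le_mul (hle k s hs) (hK s (Ioo_subset_Icc_self hs))
            (norm_nonneg _) ?_)
          exact (norm_nonneg _).trans (hle k s hs)) h0 (hterm t₀ h0) h1
    refine hder.congr_deriv ?_
    have hds : Summable fun n => d n t := (summable_nat_add_iff 1).1 ((hterm t h1).mul_right (A t))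
    rw [hds.tsum_eq_zero_add]
    change 0 + ∑' n, picardTerm A t₀ x₀ n t * A t = _
    rw [zero_add, (hterm t h1).tsum_mul_right]

end LinearODE

variable {m : ℕ} {J : Matrix (Fin m) (Fin m) ℝ} {I : Set ℝ}

/-- Every smooth curve in the Lie algebra is the velocity of a curve in the Jacobi group. -/
theorem exists_curve_leftVelocity_eq (hdet : IsUnit J.det) (hI : IsOpen I) (hI' : I.OrdConnected)
    {ξ : ℝ → JacVec m} (hξ : ContDiffOn ℝ ∞ ξ I) (hmem : ∀ t ∈ I, ξ t ∈ jacAlgebra J)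
    {t₀ : ℝ} (ht₀ : t₀ ∈ I) (p : Jac J) :
    ∃ c : ℝ → Jac J, c t₀ = p ∧ SmoothCurveOn c I ∧ ∀ t ∈ I, leftVelocity c t = ξ t := by
  obtain ⟨g, hg0, hg⟩ := exists_linear_ode (coords p).1 hI hI' ht₀ (A := fun t => (ξ t).1)
    hξ.fst.continuousOn
  have hgs : ContDiffOn ℝ ∞ g I := contDiffOn_of_hasDerivAt hI hg fun n hn =>
    hn.mul (hξ.fst.of_le (by exact_mod_cast le_top))
  set w : ℝ → Fin m → ℝ := fun t => g t *ᵥ (ξ t).2.1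
  have hw : ContDiffOn ℝ ∞ w I := contDiffOn_bilinear (mulVecBilinear m) hgs hξ.snd.fst
  set u : ℝ → Fin m → ℝ := fun t => (∫ s in t₀..t, w s) + (coords p).2.1
  have hu : ∀ t ∈ I, HasDerivAt u (w t) t := fun t ht =>
    (hasDerivAt_integral_of_continuousOn hI hI' ht₀ hw.continuousOn ht).add_const _
  have hus : ContDiffOn ℝ ∞ u I := contDiffOn_of_hasDerivAt hI hu fun n _ =>
    hw.of_le (by exact_mod_cast le_top)
  -- The second summand cancels the -½Ω(u, u̇) in `leftForm`.
  set z : ℝ → ℝ := fun t => (ξ t).2.2 + 1 / 2 * form J (u t) (w t)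
  have hz : ContDiffOn ℝ ∞ z I := hξ.snd.snd.add
    (contDiffOn_const.mul (contDiffOn_bilinear (formBilin J) hus hw))
  set a : ℝ → ℝ := fun t => (∫ s in t₀..t, z s) + (coords p).2.2
  have ha : ∀ t ∈ I, HasDerivAt a (z t) t := fun t ht =>
    (hasDerivAt_integral_of_continuousOn hI hI' ht₀ hz.continuousOn ht).add_const _
  have has : ContDiffOn ℝ ∞ a I := contDiffOn_of_hasDerivAt hI ha fun n _ =>
    hz.of_le (by exact_mod_cast le_top)
  have hT : ∀ t ∈ I, HasDerivAt (fun s => (g s)ᵀ) (g t * (ξ t).1)ᵀ t := fun t ht =>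
    hasDerivAt_linearMap (Matrix.transposeLinearEquiv (Fin m) (Fin m) ℝ ℝ).toLinearMap (hg t ht)
  -- The derivative of gJ⁻¹gᵀ is g(S₂J⁻¹ + J⁻¹S₂ᵀ)gᵀ, zero outright. For gᵀJg it would be S₂ᵀ(gᵀJg)
  -- + (gᵀJg)S₂, which needs the conclusion.
  have hW : ∀ t ∈ I, HasDerivAt (fun s => g s * J⁻¹ * (g s)ᵀ) 0 t := by
    intro t ht
    have h1 : (ξ t).1ᵀ * J + J * (ξ t).1 = 0 := hmem t ht
    refine (((hg t ht).mul_const J⁻¹).mul (hT t ht)).congr_deriv ?_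
    have h2 : (ξ t).1 * J⁻¹ + J⁻¹ * (ξ t).1ᵀ = 0 := by
      calc (ξ t).1 * J⁻¹ + J⁻¹ * (ξ t).1ᵀ
          = (J⁻¹ * J) * (ξ t).1 * J⁻¹ + J⁻¹ * (ξ t).1ᵀ * (J * J⁻¹) := by
            rw [nonsing_inv_mul _ hdet, mul_nonsing_inv _ hdet, Matrix.one_mul, Matrix.mul_one]
        _ = J⁻¹ * ((ξ t).1ᵀ * J + J * (ξ t).1) * J⁻¹ := by noncomm_ring
        _ = 0 := by rw [h1]; simp
    calc g t * (ξ t).1 * J⁻¹ * (g t)ᵀ + g t * J⁻¹ * (g t * (ξ t).1)ᵀ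
        = g t * ((ξ t).1 * J⁻¹ + J⁻¹ * (ξ t).1ᵀ) * (g t)ᵀ := by
          rw [transpose_mul]
          noncomm_ring
      _ = 0 := by rw [h2]; simp
  have hp : (coords p).1 * J⁻¹ * (coords p).1ᵀ * J = 1 := by
    have h1 : (coords p).1 * (coords p⁻¹).1 = 1 := p.right.1.mul_inv
    rw [(coords_inv hdet p).1] at h1
    simpa only [Matrix.mul_assoc] using h1
  have hgJ : ∀ t ∈ I, J⁻¹ * (g t)ᵀ * J * g t = 1 := by
    intro t ht
    have h1 : g t * J⁻¹ * (g t)ᵀ = g t₀ * J⁻¹ * (g t₀)ᵀ :=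
      hI.is_const_of_deriv_eq_zero hI'.isPreconnected
        (fun s hs => (hW s hs).differentiableAt.differentiableWithinAt)
        (fun s hs => (hW s hs).deriv) ht ht₀
    apply mul_eq_one_comm.1
    rw [← hp, ← hg0, ← h1]
    simp only [Matrix.mul_assoc]
  have hsymp : ∀ t ∈ I, (g t)ᵀ * J * g t = J := by
    intro t ht
    calc (g t)ᵀ * J * g t = (J * J⁻¹) * ((g t)ᵀ * J * g t) := by
          rw [mul_nonsing_inv _ hdet, Matrix.one_mul]
      _ = J * (J⁻¹ * (g t)ᵀ * J * g t) := by simp only [Matrix.mul_assoc]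
      _ = J := by rw [hgJ t ht, Matrix.mul_one]
  have hex : ∀ t, ∃ q : Jac J, t ∈ I → coords q = (g t, u t, a t) := by
    intro t
    by_cases ht : t ∈ I
    · obtain ⟨q, hq⟩ := exists_coords_eq hdet (p := (g t, u t, a t)) (hsymp t ht)
      exact ⟨q, fun _ => hq⟩
    · exact ⟨1, fun h => absurd h ht⟩
  choose c hc using hex
  refine ⟨c, coords_injective ?_, (hgs.prodMk (hus.prodMk has)).congr hc, fun t ht => ?_⟩
  · rw [hc t₀ ht₀]
    simp [hg0, u, a]
  · have hd : HasDerivAt (fun s => coords (c s)) (g t * (ξ t).1, w t, z t) t :=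
      ((hg t ht).prodMk ((hu t ht).prodMk (ha t ht))).congr_of_eventuallyEq (by
        filter_upwards [hI.mem_nhds ht] with s hs
        exact hc s hs)
    rw [leftVelocity_eq hdet hd, leftForm_apply, hc t ht]
    refine Prod.ext ?_ (Prod.ext ?_ ?_)
    · simp only [← Matrix.mul_assoc, hgJ t ht, Matrix.one_mul]
    · simp only [w, mulVec_mulVec, hgJ t ht, one_mulVec]
    · simp only [z]
      ring

theorem BlochIserlesOn.contDiffOn {n : ℕ} {N : Matrix (Fin n) (Fin n) ℝ}
    {X : ℝ → Matrix (Fin n) (Fin n) ℝ} (hI : IsOpen I) (hX : BlochIserlesOn N X I) :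
    ContDiffOn ℝ ∞ X I :=
  contDiffOn_of_hasDerivAt hI (fun t ht => (hX t ht).2) fun _ h =>
    ((h.pow 2).mul contDiffOn_const).sub (contDiffOn_const.mul (h.pow 2))

end BlochIserles

/-! ### The normal form of an antisymmetric matrix of corank one -/

namespace BlochIserles

/-- An antisymmetric matrix of odd size is singular. -/
theorem even_of_antisymm {m : ℕ} {A : Matrix (Fin m) (Fin m) ℝ} (hA : Aᵀ = -A)
    (hdet : IsUnit A.det) : Even m := by
  by_contra h
  have h1 := congrArg Matrix.det hA
  rw [det_transpose, det_neg, Fintype.card_fin, (Nat.not_even_iff_odd.1 h).neg_one_pow] at h1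
  exact hdet.ne_zero (by linarith)

/-- A matrix with one-dimensional kernel has an orthogonal matrix whose last column spans it. -/
theorem exists_orthogonal_ker {m n : ℕ} (N : Matrix (Fin n) (Fin n) ℝ) (hr : N.rank = m)
    (hn : m + 1 = n) : ∃ Q : Matrix (Fin n) (Fin m ⊕ Unit) ℝ, Qᵀ * Q = 1 ∧ Q * Qᵀ = 1 ∧
      N *ᵥ (Q *ᵥ Pi.single (Sum.inr ()) 1) = 0 ∧
      ∀ w, N *ᵥ w = 0 → ∃ r : ℝ, w = r • (Q *ᵥ Pi.single (Sum.inr ()) 1) := by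
  have hker : Module.finrank ℝ (LinearMap.ker N.mulVecLin) = 1 := by
    have h := N.mulVecLin.finrank_range_add_finrank_ker
    change N.rank + _ = _ at h
    rw [Module.finrank_fin_fun] at h
    omega
  obtain ⟨⟨v₀, hv₀⟩, hne, hspan⟩ := finrank_eq_one_iff'.1 hker
  have hne0 : WithLp.toLp 2 v₀ ≠ (0 : EuclideanSpace ℝ (Fin n)) := fun h => hne (by
    ext i
    exact congrArg (fun x : EuclideanSpace ℝ (Fin n) => x i) h)
  set v : EuclideanSpace ℝ (Fin n) := ‖WithLp.toLp 2 v₀‖⁻¹ • WithLp.toLp 2 v₀ with hv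
  have hvn : ‖v‖ = 1 := by
    rw [hv, norm_smul, norm_inv, norm_norm, inv_mul_cancel₀ (norm_ne_zero_iff.2 hne0)]
  have horth : Orthonormal ℝ (({Sum.inr ()} : Set (Fin m ⊕ Unit)).domRestrict fun _ => v) :=
    ⟨fun _ => hvn, fun i j hij => absurd (Subsingleton.elim i j) hij⟩
  obtain ⟨b, hb⟩ := horth.exists_orthonormalBasis_extension_of_card_eq
    (by simp [hn])
  have hbv : b (Sum.inr ()) = v := hb _ rfl
  set Q : Matrix (Fin n) (Fin m ⊕ Unit) ℝ := of fun i j => b j i with hQ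
  have hQQ : Qᵀ * Q = 1 := by
    ext j k
    rw [Matrix.mul_apply, Matrix.one_apply, ← orthonormal_iff_ite.1 b.orthonormal j k]
    simp [hQ, PiLp.inner_apply, mul_comm]
  have hcol : Q *ᵥ Pi.single (Sum.inr ()) 1 = ‖WithLp.toLp 2 v₀‖⁻¹ • v₀ := by
    ext i
    rw [mulVec_single_one]
    change b (Sum.inr ()) i = _
    rw [hbv]
    rfl
  refine ⟨Q, hQQ, (mul_eq_one_comm_of_card_eq _ _ _ (by simp [hn])).1 hQQ, ?_, ?_⟩
  · rw [hcol, mulVec_smul, show N *ᵥ v₀ = 0 from hv₀, smul_zero]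
  · intro w hw
    obtain ⟨r, hr⟩ := hspan ⟨w, hw⟩
    refine ⟨r * ‖WithLp.toLp 2 v₀‖, ?_⟩
    rw [hcol, smul_smul, mul_assoc, mul_inv_cancel₀ (norm_ne_zero_iff.2 hne0), mul_one]
    exact (congrArg Subtype.val hr).symm

/-- In a basis ending with a kernel vector the last column vanishes, and by antisymmetry the last
row. A kernel vector of the remaining block would give one of N orthogonal to the kernel line, so
the block is invertible, hence of even size. -/
theorem exists_blockForm {n : ℕ} (N : Matrix (Fin n) (Fin n) ℝ) (hN : Nᵀ = -N)
    (hcorank : N.rank + 1 = n) : ∃ (k : ℕ) (Nbar : Matrix (Fin (2 * k)) (Fin (2 * k)) ℝ)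
      (Q : Matrix (Fin n) (Fin (2 * k) ⊕ Unit) ℝ), n = 2 * k + 1 ∧ IsBlockForm N Nbar Q := by
  obtain ⟨m, hm⟩ : ∃ m, N.rank = m := ⟨_, rfl⟩
  have hn : m + 1 = n := by omega
  obtain ⟨Q, hQ, hQ', hcol, hspan⟩ := exists_orthogonal_ker N hm hn
  set T := Qᵀ * N * Q with hT
  have hNT : N = Q * T * Qᵀ := by
    calc N = (Q * Qᵀ) * N * (Q * Qᵀ) := by rw [hQ', Matrix.one_mul, Matrix.mul_one]
      _ = _ := by simp only [hT, Matrix.mul_assoc]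
  have hTa : Tᵀ = -T := by
    simp only [hT, transpose_mul, transpose_transpose, hN, Matrix.mul_assoc, Matrix.neg_mul,
      Matrix.mul_neg]
  have hTr : ∀ i, T i (Sum.inr ()) = 0 := by
    intro i
    have h1 : T *ᵥ Pi.single (Sum.inr ()) 1 = 0 := by
      rw [hT, ← mulVec_mulVec, ← mulVec_mulVec, hcol, mulVec_zero]
    rw [mulVec_single_one] at h1
    exact congrFun h1 i
  have hTl : ∀ i, T (Sum.inr ()) i = 0 := by
    intro i
    have h1 := congrFun (congrFun hTa i) (Sum.inr ())
    rw [transpose_apply, neg_apply, hTr, neg_zero] at h1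
    exact h1
  have hblock : T = fromBlocks T.toBlocks₁₁ 0 0 0 := by
    ext (i | i) (j | j)
    · rfl
    · exact hTr _
    · exact hTl _
    · exact hTr _
  have hanti : T.toBlocks₁₁ᵀ = -T.toBlocks₁₁ := by
    ext i j
    exact congrFun (congrFun hTa (Sum.inl i)) (Sum.inl j)
  have hunit : IsUnit T.toBlocks₁₁.det := by
    rw [isUnit_iff_ne_zero]
    intro h0
    obtain ⟨w, hw0, hw⟩ := exists_mulVec_eq_zero_iff.2 h0
    have h1 : N *ᵥ (Q *ᵥ Sum.elim w 0) = 0 := by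
      rw [hNT, mulVec_mulVec, Matrix.mul_assoc, hQ, Matrix.mul_one, ← mulVec_mulVec, hblock,
        fromBlocks_mulVec]
      simp [hw]
    obtain ⟨r, hr⟩ := hspan _ h1
    have h2 := congrArg (Qᵀ *ᵥ ·) hr
    simp only [mulVec_smul, mulVec_mulVec, hQ, one_mulVec] at h2
    refine hw0 (funext fun i => ?_)
    have h3 := congrFun h2 (Sum.inl i)
    simpa using h3
  obtain ⟨k, hk⟩ := even_of_antisymm hanti hunit
  obtain rfl : m = 2 * k := by omega
  exact ⟨k, T.toBlocks₁₁, Q, hn.symm, hanti, hunit, hQ, hQ', hblock ▸ hNT⟩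

end BlochIserles

/-! ### Assembly of the theorem -/

open BlochIserles
theorem mainTheorem1 {n : ℕ} (N : Matrix (Fin n) (Fin n) ℝ) (hN : Nᵀ = -N)
    (hcorank : N.rank + 1 = n) :
    (∃ (k : ℕ) (Nbar : Matrix (Fin (2 * k)) (Fin (2 * k)) ℝ)
      (Q : Matrix (Fin n) (Fin (2 * k) ⊕ Unit) ℝ), n = 2 * k + 1 ∧ IsBlockForm N Nbar Q) ∧
    ∀ (k : ℕ) (Nbar : Matrix (Fin (2 * k)) (Fin (2 * k)) ℝ)
      (Q : Matrix (Fin n) (Fin (2 * k) ⊕ Unit) ℝ), IsBlockForm N Nbar Q →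
      -- `ℓ` is the kinetic energy of an inner product
      (∃ B : LinearMap.BilinForm ℝ (JacVec (2 * k)), B.IsSymm ∧ (∀ ξ, ξ ≠ 0 → 0 < B ξ ξ) ∧
        ∀ ξ, lagrangian Nbar ξ = 1 / 2 * B ξ ξ) ∧
      -- the identification of the Lie algebra of the Jacobi group with `(Sym(ℝⁿ), [ , ]_N)`
      (IsLinearMap ℝ (symOfJac Nbar Q) ∧
        BijOn (symOfJac Nbar Q) (jacAlgebra (-Nbar⁻¹)) {S | S.IsSymm} ∧
        (∀ ξ ∈ jacAlgebra (-Nbar⁻¹), ∀ η ∈ jacAlgebra (-Nbar⁻¹),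
          symOfJac Nbar Q (jacBracket (-Nbar⁻¹) ξ η) =
            symOfJac Nbar Q ξ * N * symOfJac Nbar Q η
              - symOfJac Nbar Q η * N * symOfJac Nbar Q ξ) ∧
        ∀ ξ ∈ jacAlgebra (-Nbar⁻¹),
          lagrangian Nbar ξ = 1 / 2 * trace (symOfJac Nbar Q ξ ^ 2)) ∧
      ∀ I : Set ℝ, IsOpen I → I.OrdConnected →
        -- reduction: geodesics, Euler–Poincaré equations, Bloch–Iserles system
        (∀ c : ℝ → Jac (-Nbar⁻¹), SmoothCurveOn c I →
          (∀ t ∈ I, leftVelocity c t ∈ jacAlgebra (-Nbar⁻¹)) ∧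
          (IsGeodesicOn (lagrangian Nbar) c I ↔
            EulerPoincareOn (-Nbar⁻¹) (lagrangian Nbar) (leftVelocity c) I) ∧
          (IsGeodesicOn (lagrangian Nbar) c I ↔
            BlochIserlesOn N (fun t => symOfJac Nbar Q (leftVelocity c t)) I)) ∧
        -- reconstruction: every solution comes from a geodesic through any given point
        ∀ X : ℝ → Matrix (Fin n) (Fin n) ℝ, BlochIserlesOn N X I →
          ∀ t₀ ∈ I, ∀ p : Jac (-Nbar⁻¹), ∃ c : ℝ → Jac (-Nbar⁻¹),
            c t₀ = p ∧ IsGeodesicOn (lagrangian Nbar) c I ∧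
              ∀ t ∈ I, symOfJac Nbar Q (leftVelocity c t) = X t := by
  refine ⟨exists_blockForm N hN hcorank, fun k Nbar Q h => ?_⟩
  have hMdet : IsUnit (Nbar⁻¹).det := isUnit_nonsing_inv_det _ h.invertible
  have hJdet : IsUnit (-Nbar⁻¹).det :=
    (isUnit_iff_isUnit_det _).1 ((isUnit_iff_isUnit_det _).2 hMdet).neg
  have hJ : (-Nbar⁻¹)ᵀ = -(-Nbar⁻¹) := by
    rw [transpose_neg, transpose_nonsing_inv, h.antisymm, inv_neg_matrix _ h.invertible]
  have hℓ := lagrangian_eq h.antisymm h.invertible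
  refine ⟨⟨metric Nbar⁻¹, ⟨metric_comm _⟩, fun ξ hξ => metric_pos hMdet hξ, hℓ⟩,
    ⟨isLinearMap_symOfJac Nbar Q, bijOn_symOfJac h, fun ξ hξ η hη => symOfJac_bracket h hξ hη,
      fun ξ hξ => ?_⟩, fun I hI hI' => ?_⟩
  · rw [hℓ, metric_eq_trace h, (isSymm_symOfJac h hξ).eq, pow_two]
  have hmem : ∀ c : ℝ → Jac (-Nbar⁻¹), SmoothCurveOn c I →
      ∀ t ∈ I, leftVelocity c t ∈ jacAlgebra (-Nbar⁻¹) :=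
    fun c hc t ht => hc.leftVelocity_mem hJdet hJ hI ht
  have hEP : ∀ c : ℝ → Jac (-Nbar⁻¹), SmoothCurveOn c I →
      (IsGeodesicOn (lagrangian Nbar) c I ↔
        EulerPoincareOn (-Nbar⁻¹) (lagrangian Nbar) (leftVelocity c) I) := fun c hc =>
    (isGeodesicOn_iff hJdet hJ hℓ hI hc).trans (eulerPoincareOn_iff_deriv (fderiv_lagrangian h) hI
      (hc.contDiffOn_leftVelocity hJdet hI)).symm
  have hBI : ∀ c : ℝ → Jac (-Nbar⁻¹), SmoothCurveOn c I →
      (IsGeodesicOn (lagrangian Nbar) c I ↔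
        BlochIserlesOn N (fun t => symOfJac Nbar Q (leftVelocity c t)) I) := fun c hc =>
    (hEP c hc).trans (eulerPoincareOn_iff h hN hI (hmem c hc))
  refine ⟨fun c hc => ⟨hmem c hc, hEP c hc, hBI c hc⟩, fun X hX t₀ ht₀ p => ?_⟩
  obtain ⟨c, hc0, hc, hvel⟩ := exists_curve_leftVelocity_eq hJdet hI hI'
    (contDiffOn_linearMap (jacOfSym Nbar Q) (hX.contDiffOn hI))
    (fun t ht => jacOfSym_mem h (hX t ht).1) ht₀ p
  have hsym : ∀ t ∈ I, symOfJac Nbar Q (leftVelocity c t) = X t := fun t ht => by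
    rw [hvel t ht, symOfJac_jacOfSym h (hX t ht).1]
  refine ⟨c, hc0, (hBI c hc).2 fun t ht => ?_, hsym⟩
  -- Φ(c⁻¹ċ) and X agree only on I, so the derivative is transferred through a neighbourhood of t in
  -- I.
  simp only [hsym t ht]
  refine ⟨(hX t ht).1, (hX t ht).2.congr_of_eventuallyEq ?_⟩
  filter_upwards [hI.mem_nhds ht] with s hs
  exact hsym s hs
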